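/- Let $p$ be a prime, $R=\mathbb F_p[t]$, and let $\mathbb F$ be a finite extension of $\mathbb F_p(t)$. Let $K/\mathbb F$ be a field extension of transcendence degree at least $1$ which is the function field of a projective, smooth, geometrically irreducible variety $\mathcal V$ over $\mathbb F$, and let $\Omega$ be the set of places of $K$ attached to the irreducible divisors of $\mathcal V$. For $v\in\Omega$ let $K_v$ be the completion of $K$ at $v$ and $\mathcal O_v$ its ring of integers. Let $\Phi:R\to\operatorname{End}_K(\mathbb G_a)$ be a Drinfeld module of special characteristic, i.e. a ring homomorphism into the ring of additive polynomials over $K$ (under addition and composition) with $\Phi_t(x)=\sum_{i=d}^{D}c_ix^{p^i}$, $1\le d\le D$, $c_i\in K$, $c_d,c_D\neq 0$. Assume that $\Phi[t^\infty](K^{\rm sep})=\{x\in K^{\rm sep}:\Phi_{t^n}(x)=0\text{ for some }n\ge 0\}$ is finite, and that $\Phi$ has positive modular transcendence degree, where the modular transcendence degree of $\Phi$ is the least integer $m\ge 0$ for which there are a subfield $L\subseteq\overline K$ of transcendence degree $m$ over $\mathbb F_p$ and a $\gamma\in\overline K\setminus\{0\}$ with $\gamma^{-1}\Phi_t(\gamma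 x)\in L[x]$. Let $g\ge 1$ and let $R$ act on $K^g$ diagonally through $\Phi$. Let $\Gamma\subseteq K^g$ be a finitely generated $R$-submodule which is full in $K$, i.e. every $x\in K^g$ with $\Phi_b(x)\in\Gamma$ for some nonzero $b\in R$ lies in $\Gamma$. Let $\Omega_1$ be the set of all $v\in\Omega$ such that all coefficients of $\Phi_t$ are integral at $v$, the first and the last nonzero coefficients of $\Phi_t$ are $v$-adic units, and all points of $\Gamma$ are integral at $v$. Let $\mathbf A_K$ be the restricted product of the $(K_v,\mathcal O_v)$ over $v\in\Omega_1$, with $R$ acting through $\Phi$, and let $\overline\Gamma$ be the closure of the diagonal image of $\Gamma$ in $\mathbf A_K^g$ (with the product topology); it is an $R$-submodule of $\mathbf A_K^g$. Then for each nonzero $a\in R$ the natural map $\Gamma/\Phi_a(\Gamma)\to\overline\Gamma/\Phi_a(\overline\Gamma)$ is an isomorphism of $R$-modules. -/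

import Mathlib

open Polynomial CategoryTheory AlgebraicGeometry

universe u

namespace DrinfeldAdele

/-! ### Endomorphisms of the additive group: additive polynomials under composition -/

/-- An additive polynomial over `K`: a polynomial `f` in one variable with
`f(X + Y) = f(X) + f(Y)` in `K[X, Y]`. -/
@[ext]
structure AdditivePolynomial (K : Type u) [Field K] where
  /-- the underlying polynomial -/
  poly : K[X]
  additive : aeval (MvPolynomial.X 0 + MvPolynomial.X 1 : MvPolynomial (Fin 2) K) poly =
    aeval (MvPolynomial.X 0 : MvPolynomial (Fin 2) K) poly +
      aeval (MvPolynomial.X 1 : MvPolynomial (Fin 2) K) poly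

namespace AdditivePolynomial

variable {K : Type u} [Field K]

theorem aeval_add_arg (f : AdditivePolynomial K) {L : Type*} [CommRing L] [Algebra K L]
    (x y : L) : aeval (x + y) f.poly = aeval x f.poly + aeval y f.poly := by
  have h := congrArg (MvPolynomial.aeval (R := K) ![x, y]) f.additive
  simpa [← Polynomial.aeval_algHom_apply] using h

theorem comp_add_arg (f : AdditivePolynomial K) (q r : K[X]) :
    f.poly.comp (q + r) = f.poly.comp q + f.poly.comp r := by
  have h := f.aeval_add_arg (L := K[X]) q r
  simpa [Polynomial.comp, Polynomial.aeval_def] using h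

noncomputable instance : Zero (AdditivePolynomial K) := ⟨⟨0, by simp⟩⟩
noncomputable instance : One (AdditivePolynomial K) := ⟨⟨X, by simp⟩⟩
noncomputable instance : Add (AdditivePolynomial K) :=
  ⟨fun f g => ⟨f.poly + g.poly, by simp only [map_add, f.additive, g.additive]; ring⟩⟩
noncomputable instance : Neg (AdditivePolynomial K) :=
  ⟨fun f => ⟨-f.poly, by simp only [map_neg, f.additive]; ring⟩⟩
/-- Multiplication is composition. -/
noncomputable instance : Mul (AdditivePolynomial K) :=
  ⟨fun f g => ⟨f.poly.comp g.poly, by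
    simp only [Polynomial.aeval_comp, g.additive, f.aeval_add_arg]⟩⟩

@[simp] theorem poly_zero : (0 : AdditivePolynomial K).poly = 0 := rfl
@[simp] theorem poly_one : (1 : AdditivePolynomial K).poly = X := rfl
@[simp] theorem poly_add (f g : AdditivePolynomial K) : (f + g).poly = f.poly + g.poly := rfl
@[simp] theorem poly_neg (f : AdditivePolynomial K) : (-f).poly = -f.poly := rfl
@[simp] theorem poly_mul (f g : AdditivePolynomial K) : (f * g).poly = f.poly.comp g.poly := rfl

/-- The ring of endomorphisms of the additive group over `K`: additive polynomials under
addition and composition. -/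
noncomputable instance : Ring (AdditivePolynomial K) where
  add_assoc f g h := by ext1; simp [add_assoc]
  zero_add f := by ext1; simp
  add_zero f := by ext1; simp
  add_comm f g := by ext1; simp [add_comm]
  neg_add_cancel f := by ext1; simp
  mul_assoc f g h := by ext1; simp [Polynomial.comp_assoc]
  one_mul f := by ext1; simp
  mul_one f := by ext1; simp
  left_distrib f g h := by ext1; simp [comp_add_arg]
  right_distrib f g h := by ext1; simp
  zero_mul f := by ext1; simp
  mul_zero f := by
    ext1
    have h := f.comp_add_arg 0 0
    simpa using h
  nsmul := nsmulRec
  zsmul := zsmulRec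

/-- The action of additive polynomials over `K` on a commutative `K`-algebra `L` by evaluation. -/
noncomputable def evalHom (L : Type*) [CommRing L] [Algebra K L] :
    AdditivePolynomial K →+* AddMonoid.End L where
  toFun f := AddMonoidHom.mk' (fun x => aeval x f.poly) f.aeval_add_arg
  map_one' := AddMonoidHom.ext fun x => Polynomial.aeval_X x
  map_mul' _ _ := AddMonoidHom.ext fun x => Polynomial.aeval_comp x
  map_zero' := AddMonoidHom.ext fun x => map_zero (aeval x)
  map_add' f g := AddMonoidHom.ext fun x => map_add (aeval x) f.poly g.poly

@[simp] theorem evalHom_apply (L : Type*) [CommRing L] [Algebra K L] (f : AdditivePolynomial K)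
    (x : L) : evalHom L f x = aeval x f.poly := rfl

end AdditivePolynomial

/-! ### Drinfeld modules of special characteristic -/

/-- A Drinfeld module `Φ : 𝔽_p[t] → End_K(𝔾_a)` of special characteristic:
`Φ_t = ∑_{d ≤ i ≤ D} c_i x^{p^i}` with `1 ≤ d ≤ D` and `c_d`, `c_D` nonzero. -/
structure SpecialDrinfeldModule (p : ℕ) (K : Type u) [Field K] where
  /-- the ring homomorphism -/
  hom : (ZMod p)[X] →+* AdditivePolynomial K
  special : ∃ (d D : ℕ) (c : ℕ → K), 1 ≤ d ∧ d ≤ D ∧ c d ≠ 0 ∧ c D ≠ 0 ∧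
    (hom X).poly = ∑ i ∈ Finset.Icc d D, C (c i) * X ^ p ^ i

variable {p : ℕ} {K : Type u} [Field K]

/-- `𝔾_a(L)`, i.e. a copy of the `K`-algebra `L`, regarded as an `𝔽_p[t]`-module via `Φ`. -/
def Pt (_Φ : SpecialDrinfeldModule p K) (L : Type*) : Type _ := L

section Pt

variable (Φ : SpecialDrinfeldModule p K) (L : Type*) [CommRing L] [Algebra K L]

instance : AddCommGroup (Pt Φ L) := inferInstanceAs (AddCommGroup L)

/-- The ring homomorphism sending `a` to the endomorphism `x ↦ Φ_a(x)` of `𝔾_a(L)`. -/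
noncomputable def actionHom : (ZMod p)[X] →+* AddMonoid.End (Pt Φ L) :=
  (AdditivePolynomial.evalHom L).comp Φ.hom

/-- `a • x = Φ_a(x)`. -/
noncomputable instance : Module (ZMod p)[X] (Pt Φ L) :=
  Module.compHom (Pt Φ L) (actionHom Φ L)

theorem smul_def (a : (ZMod p)[X]) (x : Pt Φ L) :
    a • x = (aeval (R := K) (A := L) x (Φ.hom a).poly : L) := rfl

end Pt

/-- The full divisible hull of `Γ` inside `K^g`: all `x` with `Φ_a(x) ∈ Γ` for some nonzero `a`. -/
def divisibleHull {Φ : SpecialDrinfeldModule p K} {g : ℕ}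
    (Γ : Submodule (ZMod p)[X] (Fin g → Pt Φ K)) : Set (Fin g → Pt Φ K) :=
  {x | ∃ a : (ZMod p)[X], a ≠ 0 ∧ a • x ∈ Γ}

/-- `Γ` is full in `K` if it equals its full divisible hull. -/
def IsFull {Φ : SpecialDrinfeldModule p K} {g : ℕ}
    (Γ : Submodule (ZMod p)[X] (Fin g → Pt Φ K)) : Prop :=
  (Γ : Set (Fin g → Pt Φ K)) = divisibleHull Γ

/-- `Φ[t^∞](L)`, the points of `L` killed by some power of `t`. -/
def tPowerTorsion (Φ : SpecialDrinfeldModule p K) (L : Type*) [CommRing L] [Algebra K L] :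
    Set (Pt Φ L) :=
  {x | ∃ n : ℕ, (X ^ n : (ZMod p)[X]) • x = 0}

/-- The modular transcendence degree of `Φ`: the least `d` for which there are a subfield `L` of an
algebraic closure of `K`, of transcendence degree `d` over the prime field, and a nonzero `γ` in
the algebraic closure such that `γ⁻¹ Φ_t(γ x)` has all its coefficients in `L`. -/
noncomputable def modularTrdeg (Φ : SpecialDrinfeldModule p K) : ℕ :=
  sInf {d : ℕ | ∃ (L : Subfield (AlgebraicClosure K)) (γ : AlgebraicClosure K),
    Algebra.trdeg (⊥ : Subfield L) L = d ∧ γ ≠ 0 ∧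
      ∀ n : ℕ, (C γ⁻¹ * ((Φ.hom X).poly.map (algebraMap K (AlgebraicClosure K))).comp
        (C γ * X)).coeff n ∈ L}

/-! ### Places attached to prime divisors of a smooth projective variety -/

/-- Projective space of dimension `n` over `F`, as `Proj F[x_0, …, x_n]`. -/
noncomputable def projectiveSpace (n : ℕ) (F : Type u) [Field F] : Scheme.{u} :=
  letI := MvPolynomial.gradedAlgebra (σ := Fin (n + 1)) (R := F)
  Proj (MvPolynomial.homogeneousSubmodule (Fin (n + 1)) F)

/-- The structure morphism of projective space. -/
noncomputable def projectiveSpaceToSpec (n : ℕ) (F : Type u) [Field F] :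
    projectiveSpace n F ⟶ Spec (CommRingCat.of F) :=
  letI := MvPolynomial.gradedAlgebra (σ := Fin (n + 1)) (R := F)
  Proj.toSpecZero (MvPolynomial.homogeneousSubmodule (Fin (n + 1)) F) ≫
    Spec.map (CommRingCat.ofHom
      (algebraMap F (MvPolynomial.homogeneousSubmodule (Fin (n + 1)) F 0)))

/-- A projective, smooth, geometrically irreducible variety over `F` whose function field is the
extension `K` of `F`. -/
structure SmoothProjectiveModel (F K : Type u) [Field F] [Field K] [Algebra F K] where
  /-- the variety -/
  scheme : Scheme.{u}
  /-- its structure morphism -/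
  toSpec : scheme ⟶ Spec (CommRingCat.of F)
  [isIntegral : IsIntegral scheme]
  [smooth : Smooth toSpec]
  [geometricallyIrreducible : GeometricallyIrreducible toSpec]
  projective : ∃ (n : ℕ) (i : scheme ⟶ projectiveSpace n F),
    IsClosedImmersion i ∧ i ≫ projectiveSpaceToSpec n F = toSpec
  /-- the identification of the function field with `K` -/
  functionFieldEquiv : scheme.functionField ≃+* K
  /-- the identification is one of extensions of `F` -/
  functionFieldEquiv_base : ∀ c : F,
    functionFieldEquiv (scheme.presheaf.germ ⊤ (genericPoint scheme) trivial
      (toSpec.appTop ((Scheme.ΓSpecIso (CommRingCat.of F)).inv c))) = algebraMap F K c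

attribute [instance] SmoothProjectiveModel.isIntegral

/-- The set `Ω` of places of `K` attached to the irreducible divisors of the variety: a place is
given by its valuation ring in `K`, the local ring of a point of codimension one. -/
def SmoothProjectiveModel.places {F K : Type u} [Field F] [Field K] [Algebra F K]
    (V : SmoothProjectiveModel F K) : Set (ValuationSubring K) :=
  {A | ∃ x : V.scheme, Order.coheight x = 1 ∧
    (A : Set K) = Set.range fun s : V.scheme.presheaf.stalk x =>
      V.functionFieldEquiv (algebraMap _ V.scheme.functionField s)}

/-- The set `Ω₁` of the places in `Ω` at which all coefficients of `Φ_t` are integral, its first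
and last nonzero coefficients are units, and all points of `Γ` are integral. -/
def goodPlaces (Ω : Set (ValuationSubring K)) (Φ : SpecialDrinfeldModule p K) {g : ℕ}
    (Γ : Submodule (ZMod p)[X] (Fin g → Pt Φ K)) : Set (ValuationSubring K) :=
  {A | A ∈ Ω ∧ (∀ n, (Φ.hom X).poly.coeff n ∈ A) ∧
    A.valuation (Φ.hom X).poly.trailingCoeff = 1 ∧ A.valuation (Φ.hom X).poly.leadingCoeff = 1 ∧
    ∀ γ ∈ Γ, ∀ i, (γ i : K) ∈ A}

/-! ### Adeles -/

/-- The completion `K_v` is a `K`-algebra. -/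
noncomputable instance (A : ValuationSubring K) : Algebra K A.valuation.Completion :=
  ((UniformSpace.Completion.coeRingHom (α := WithVal A.valuation)).comp
    (WithVal.equiv A.valuation).symm.toRingHom).toAlgebra

/-- The ring `𝒪_v` of integers of `K_v`. -/
noncomputable abbrev integers (A : ValuationSubring K) : ValuationSubring A.valuation.Completion :=
  (Valued.v : Valuation A.valuation.Completion A.ValueGroup).valuationSubring

/-- The adeles with respect to a set `S` of places: the restricted product of the `K_v` with respect
to the `𝒪_v`, with its restricted product topology. -/
abbrev Adeles (S : Set (ValuationSubring K)) : Type u :=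
  RestrictedProduct (fun v : S => v.1.valuation.Completion) (fun v : S => integers v.1)
    Filter.cofinite

theorem algebraMap_mem_integers {A : ValuationSubring K} {x : K} (hx : x ∈ A) :
    algebraMap K A.valuation.Completion x ∈ integers A := by
  rw [Valuation.mem_valuationSubring_iff]
  change Valued.v ((WithVal.toVal A.valuation x : WithVal A.valuation) :
    A.valuation.Completion) ≤ 1
  rw [Valued.valuedCompletion_apply]
  exact (A.valuation_le_one_iff x).2 hx

instance (S : Set (ValuationSubring K)) :
    Fact (∀ v : S, IsOpen (integers v.1 : Set v.1.valuation.Completion)) :=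
  ⟨fun _ => Valued.isOpen_valuationSubring _⟩

theorem action_mem_integers (Φ : SpecialDrinfeldModule p K) {A : ValuationSubring K}
    (hA : ∀ n, (Φ.hom X).poly.coeff n ∈ A) (a : (ZMod p)[X]) :
    ∀ x : A.valuation.Completion, x ∈ integers A →
      (aeval x (Φ.hom a).poly : A.valuation.Completion) ∈ integers A := by
  have hcast : ∀ n : ℤ, ∀ x : A.valuation.Completion, x ∈ integers A →
      (aeval x (n : AdditivePolynomial K).poly : A.valuation.Completion) ∈ integers A := by
    intro n x hx
    have h : AdditivePolynomial.evalHom A.valuation.Completion (n : AdditivePolynomial K) x =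
        n • x := by rw [map_intCast]; rfl
    rw [← AdditivePolynomial.evalHom_apply, h]
    exact zsmul_mem hx n
  have hX : ∀ x : A.valuation.Completion, x ∈ integers A →
      (aeval x (Φ.hom X).poly : A.valuation.Completion) ∈ integers A := by
    intro x hx
    rw [Polynomial.aeval_eq_sum_range]
    refine sum_mem fun i _ => ?_
    rw [Algebra.smul_def]
    exact mul_mem (algebraMap_mem_integers (hA i)) (pow_mem hx i)
  induction a using Polynomial.induction_on' with
  | add a b ha hb =>
    intro x hx
    rw [map_add, AdditivePolynomial.poly_add, map_add]
    exact add_mem (ha x hx) (hb x hx)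
  | monomial n c =>
    obtain ⟨k, rfl⟩ := ZMod.intCast_surjective c
    rw [← C_mul_X_pow_eq_monomial, map_mul, map_pow, show (C ((k : ℤ) : ZMod p) : (ZMod p)[X]) = ((k : ℤ) : (ZMod p)[X]) from map_intCast C k,
      map_intCast]
    intro x hx
    rw [AdditivePolynomial.poly_mul, Polynomial.aeval_comp]
    apply hcast
    induction n generalizing x with
    | zero => simpa using hx
    | succ n ih =>
      rw [pow_succ, AdditivePolynomial.poly_mul, Polynomial.aeval_comp]
      exact ih _ (hX x hx)

section AdelicPoints

variable (Ω : Set (ValuationSubring K)) (Φ : SpecialDrinfeldModule p K) {g : ℕ}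
  (Γ : Submodule (ZMod p)[X] (Fin g → Pt Φ K))

/-- The adele ring `𝐀_K` with respect to the places in `Ω₁`, regarded as an `𝔽_p[t]`-module
via `Φ`. -/
def AdelePt : Type u := Adeles (goodPlaces Ω Φ Γ)

noncomputable instance : AddCommGroup (AdelePt Ω Φ Γ) :=
  inferInstanceAs (AddCommGroup (Adeles (goodPlaces Ω Φ Γ)))

noncomputable instance : TopologicalSpace (AdelePt Ω Φ Γ) :=
  inferInstanceAs (TopologicalSpace (Adeles (goodPlaces Ω Φ Γ)))

instance : IsTopologicalAddGroup (AdelePt Ω Φ Γ) :=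
  inferInstanceAs (IsTopologicalAddGroup (Adeles (goodPlaces Ω Φ Γ)))

/-- `(x_v)_v ↦ (Φ_a(x_v))_v` on the adeles. -/
noncomputable def adeleAction (a : (ZMod p)[X]) (x : AdelePt Ω Φ Γ) : AdelePt Ω Φ Γ :=
  RestrictedProduct.map
    (fun (v : goodPlaces Ω Φ Γ) (y : v.1.valuation.Completion) => aeval y (Φ.hom a).poly)
    (Filter.Eventually.of_forall fun v y hy => action_mem_integers Φ v.2.2.1 a y hy) x

/-- `a • (x_v)_v = (Φ_a(x_v))_v`. -/
noncomputable instance : Module (ZMod p)[X] (AdelePt Ω Φ Γ) where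
  smul := adeleAction Ω Φ Γ
  one_smul x := RestrictedProduct.ext _ _ fun v =>
    one_smul (α := Pt Φ v.1.valuation.Completion) (ZMod p)[X] (x.1 v)
  mul_smul a b x := RestrictedProduct.ext _ _ fun v =>
    mul_smul (β := Pt Φ v.1.valuation.Completion) a b (x.1 v)
  smul_zero a := RestrictedProduct.ext _ _ fun v =>
    smul_zero (A := Pt Φ v.1.valuation.Completion) a
  smul_add a x y := RestrictedProduct.ext _ _ fun v =>
    smul_add (A := Pt Φ v.1.valuation.Completion) a (x.1 v) (y.1 v)
  add_smul a b x := RestrictedProduct.ext _ _ fun v =>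
    add_smul (M := Pt Φ v.1.valuation.Completion) a b (x.1 v)
  zero_smul x := RestrictedProduct.ext _ _ fun v =>
    zero_smul (A := Pt Φ v.1.valuation.Completion) (ZMod p)[X] (x.1 v)

theorem continuous_adeleAction (a : (ZMod p)[X]) : Continuous (adeleAction Ω Φ Γ a) :=
  RestrictedProduct.mapAlong_continuous
    (fun v : goodPlaces Ω Φ Γ => v.1.valuation.Completion)
    (fun v : goodPlaces Ω Φ Γ => v.1.valuation.Completion) id Filter.tendsto_id
    (fun (v : goodPlaces Ω Φ Γ) (y : v.1.valuation.Completion) => aeval y (Φ.hom a).poly)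
    (Filter.Eventually.of_forall fun v y hy => action_mem_integers Φ v.2.2.1 a y hy)
    fun _ => Polynomial.continuous_aeval _

instance : ContinuousConstSMul (ZMod p)[X] (AdelePt Ω Φ Γ) where
  continuous_const_smul a := continuous_adeleAction Ω Φ Γ a

/-- The diagonal map `Γ → 𝐀_K^g`. -/
noncomputable def diagonal : Γ →ₗ[(ZMod p)[X]] (Fin g → AdelePt Ω Φ Γ) where
  toFun γ i := RestrictedProduct.mk
    (fun v => algebraMap K v.1.valuation.Completion (γ.1 i))
    (Filter.Eventually.of_forall fun v =>
      algebraMap_mem_integers (v.2.2.2.2.2 γ.1 γ.2 i))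
  map_add' γ δ := funext fun i => RestrictedProduct.ext _ _ fun v =>
    map_add (algebraMap K v.1.valuation.Completion) (γ.1 i) (δ.1 i)
  map_smul' a γ := funext fun i => RestrictedProduct.ext _ _ fun v =>
    (Polynomial.aeval_algebraMap_apply (A := K) v.1.valuation.Completion (γ.1 i)
      (Φ.hom a).poly).symm

/-- The adelic closure of `Γ`: the closure of (the diagonal image of) `Γ` in `𝐀_K^g` with its
product topology, as an `𝔽_p[t]`-submodule. -/
noncomputable def adelicClosure : Submodule (ZMod p)[X] (Fin g → AdelePt Ω Φ Γ) :=
  (LinearMap.range (diagonal Ω Φ Γ)).topologicalClosure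

/-- The natural map from `Γ` to its adelic closure. -/
noncomputable def toClosure : Γ →ₗ[(ZMod p)[X]] adelicClosure Ω Φ Γ :=
  (diagonal Ω Φ Γ).codRestrict _ fun γ =>
    Submodule.le_topologicalClosure _ (LinearMap.mem_range_self _ γ)

/-- `Φ_a(M)` for a module `M` over `𝔽_p[t]` acting via `Φ`. -/
noncomputable def mulRange (M : Type*) [AddCommGroup M] [Module (ZMod p)[X] M] (a : (ZMod p)[X]) :
    Submodule (ZMod p)[X] M :=
  LinearMap.range (LinearMap.lsmul (ZMod p)[X] M a)

/-- The natural map `Γ / Φ_a(Γ) → Γ̄ / Φ_a(Γ̄)` induced by the diagonal map. -/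
noncomputable def quotientMap (a : (ZMod p)[X]) :
    (Γ ⧸ mulRange Γ a) →ₗ[(ZMod p)[X]]
      (adelicClosure Ω Φ Γ ⧸ mulRange (adelicClosure Ω Φ Γ) a) :=
  Submodule.mapQ _ _ (toClosure Ω Φ Γ) <| by
    rintro _ ⟨γ, rfl⟩
    exact ⟨toClosure Ω Φ Γ γ, ((toClosure Ω Φ Γ).map_smul a γ).symm⟩

end AdelicPoints

end DrinfeldAdele

/-! `Γ` is already discrete in `𝐀_K^g`. A discrete subgroup of a Hausdorff group is closed, so `Γ`
equals its adelic closure and the quotients by `Φ_a` agree. Discreteness means that finitely many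
good places separate the points of `Γ` (`exists_finset_commonKernel_eq_bot`). Take finitely many
places for which the submodule of points reducing to zero at all of them has minimal rank. If this
submodule contained a non-torsion point, a place where that point has non-torsion reduction would
lower the rank. So it is torsion, hence finite, and one more place, at which its nonzero coordinates
are units, makes it trivial.

The core is `exists_place_forall_smul_notMem_reductionKernel`. For a non-torsion `x ∈ K`, the orbit
`Φ_{t^n}(x)` is infinite. By a Northcott-type finiteness (`finite_setOf_forall_valuation_le`), at
some valuation ring `W` of `K` some `y = Φ_{t^n}(x)` exceeds `1`, `1/c_D` and all `c_i/c_D`. From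
there the orbit escapes to infinity at `W`. `W` itself may be a bad place, or no place of the
variety.

The remedy is to spread out. The inequalities at `W` say that finitely many elements lie in the
maximal ideal of `W`, hence in a maximal ideal `m` of a finitely generated algebra `B ⊆ W` with
fraction field `K`. Since `K` has transcendence degree at least two over `𝔽_p`, `m` has height at
least two. It therefore contains a height-one prime `P` avoiding any given nonzero element. This
freedom makes `O = B_P` a good place of the variety (`exists_valuationSubring`, `exists_chart`). The
escape takes place in the local ring `B_m ⊆ B_P` and gives `1/Φ_b(y) ∈ O` for every `b ≠ 0`. So no
`Φ_b(y)`, and hence no `Φ_b(x)`, reduces to zero at `O`. -/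

/-! ### Finiteness of the set of elements bounded at every valuation ring. -/

namespace ValuationBound

/-- An element lying in every valuation ring that contains the image of `R` is integral over `R`. -/
theorem isIntegral_of_forall_valuationSubring {R K : Type*} [CommRing R] [Field K] [Algebra R K]
    {x : K} (h : ∀ W : ValuationSubring K, (∀ r, algebraMap R K r ∈ W) → x ∈ W) :
    IsIntegral R x := by
  have hmem : x ∈ (integralClosure (Subring.closure (Set.range (algebraMap R K))) K).toSubring := by
    rw [← iInf_valuationSubring_superset, Subring.mem_iInf]
    rintro ⟨W, hW⟩
    exact h W fun r => hW ⟨r, rfl⟩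
  have hcl : Subring.closure (Set.range (algebraMap R K)) = (algebraMap R K).range :=
    (Subring.closure_eq_of_le (by simp) (by rintro _ ⟨r, rfl⟩; exact Subring.subset_closure ⟨r, rfl⟩))
  have hx : IsIntegral (Subring.closure (Set.range (algebraMap R K))) x := hmem
  rw [hcl] at hx
  obtain ⟨q, hq, hq0⟩ := hx
  have hlift : q ∈ Polynomial.lifts (algebraMap R K).rangeRestrict := by
    rw [Polynomial.lifts_iff_coeff_lifts]
    intro n
    exact (algebraMap R K).rangeRestrict_surjective _
  obtain ⟨q', hq', -, hmon⟩ := Polynomial.lifts_and_natDegree_eq_and_monic hlift hq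
  refine ⟨q', hmon, ?_⟩
  rw [← hq', Polynomial.eval₂_map] at hq0
  exact hq0

theorem mem_of_isIntegral {R K : Type*} [CommRing R] [Field K] [Algebra R K]
    {W : ValuationSubring K} (hW : ∀ r, algebraMap R K r ∈ W) {x : K} (hx : IsIntegral R x) :
    x ∈ W := by
  let f : R →+* W := (algebraMap R K).codRestrict W.toSubring hW
  have hx' : IsIntegral W x := by
    obtain ⟨q, hq, hq0⟩ := hx
    refine ⟨q.map f, hq.map f, ?_⟩
    rw [Polynomial.eval₂_map]
    exact hq0
  obtain ⟨y, hy⟩ := IsIntegrallyClosed.isIntegral_iff.1 hx'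
  exact hy ▸ y.2

/-- A common denominator of `U` over `R` also clears the denominators of every `y` dominated by `U`,
because integrality can be tested on valuation rings. The trace of an integral element lies in the
normal ring `R`. The point is that `d` does not depend on `y`. -/
theorem exists_mul_trace_mem_range {R L K : Type*} [CommRing R] [IsDomain R] [IsIntegrallyClosed R]
    [Field L] [Algebra R L] [IsFractionRing R L] [Field K] [Algebra L K] [FiniteDimensional L K]
    [Algebra R K] [IsScalarTower R L K] (U : Finset K) :
    ∃ d : R, d ≠ 0 ∧ ∀ y : K, (∀ W : ValuationSubring K, ∃ u ∈ U, W.valuation y ≤ W.valuation u) →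
      ∃ r : R, algebraMap R L r = algebraMap R L d * Algebra.trace L K y := by
  have hex : ∀ u : K, ∃ d : R, d ≠ 0 ∧ IsIntegral R (algebraMap R K d * u) := by
    intro u
    obtain ⟨⟨d, hd⟩, h⟩ := IsIntegral.exists_multiple_integral_of_isLocalization (Rₘ := L)
      (nonZeroDivisors R) u (Algebra.IsIntegral.isIntegral u)
    exact ⟨d, nonZeroDivisors.ne_zero hd, by simpa [Submonoid.smul_def, Algebra.smul_def] using h⟩
  choose d hd0 hd using hex
  -- The dominating `u` varies with `W`, so one denominator must serve for all of `U`.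
  refine ⟨∏ u ∈ U, d u, Finset.prod_ne_zero_iff.2 fun u _ => hd0 u, fun y hy => ?_⟩
  have hint : IsIntegral R (algebraMap R K (∏ u ∈ U, d u) * y) := by
    refine isIntegral_of_forall_valuationSubring fun W hW => ?_
    obtain ⟨u, hu, hle⟩ := hy W
    have hmem : algebraMap R K (∏ u ∈ U, d u) * u ∈ W := by
      refine mem_of_isIntegral hW ?_
      classical
      rw [← Finset.mul_prod_erase _ _ hu, map_mul, mul_right_comm]
      exact (hd u).mul isIntegral_algebraMap
    rw [← W.valuation_le_one_iff, map_mul] at hmem ⊢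
    exact (mul_le_mul_right hle _).trans hmem
  have htr := Algebra.isIntegral_trace (L := L) hint
  obtain ⟨r, hr⟩ := IsIntegrallyClosed.isIntegral_iff.1 htr
  refine ⟨r, hr.trans ?_⟩
  rw [IsScalarTower.algebraMap_apply R L K, ← Algebra.smul_def, map_smul, smul_eq_mul]

section Degree

variable {σ k L : Type*} [Field k] [Field L] [Algebra (MvPolynomial σ k) L]
  [IsFractionRing (MvPolynomial σ k) L]

variable (σ k L) in
/-- The valuation ring of the total degree on the field of rational functions. -/
def degreeValuationSubring : ValuationSubring L where
  carrier := {x | ∃ f g : MvPolynomial σ k, g ≠ 0 ∧ x = algebraMap _ L f / algebraMap _ L g ∧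
    f.totalDegree ≤ g.totalDegree}
  mul_mem' := by
    rintro _ _ ⟨f, g, hg, rfl, h⟩ ⟨f', g', hg', rfl, h'⟩
    refine ⟨f * f', g * g', mul_ne_zero hg hg', by rw [map_mul, map_mul, div_mul_div_comm], ?_⟩
    rw [MvPolynomial.totalDegree_mul_of_isDomain hg hg']
    exact (MvPolynomial.totalDegree_mul _ _).trans (add_le_add h h')
  one_mem' := ⟨1, 1, one_ne_zero, by simp, le_rfl⟩
  add_mem' := by
    rintro _ _ ⟨f, g, hg, rfl, h⟩ ⟨f', g', hg', rfl, h'⟩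
    have hinj := IsFractionRing.injective (MvPolynomial σ k) L
    refine ⟨f * g' + g * f', g * g', mul_ne_zero hg hg', ?_, ?_⟩
    · rw [div_add_div _ _ ((map_ne_zero_iff _ hinj).2 hg) ((map_ne_zero_iff _ hinj).2 hg')]
      simp
    · rw [MvPolynomial.totalDegree_mul_of_isDomain hg hg']
      refine (MvPolynomial.totalDegree_add _ _).trans (max_le ?_ ?_)
      · exact (MvPolynomial.totalDegree_mul _ _).trans (add_le_add h le_rfl)
      · exact (MvPolynomial.totalDegree_mul _ _).trans (add_le_add le_rfl h')
  zero_mem' := ⟨0, 1, one_ne_zero, by simp, by simp⟩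
  neg_mem' := by
    rintro _ ⟨f, g, hg, rfl, h⟩
    exact ⟨-f, g, hg, by rw [map_neg, neg_div], by rwa [MvPolynomial.totalDegree_neg]⟩
  mem_or_inv_mem' := by
    intro x
    obtain ⟨f, g, hg, rfl⟩ := IsFractionRing.div_surjective (A := MvPolynomial σ k) x
    have hg0 := nonZeroDivisors.ne_zero hg
    rcases eq_or_ne f 0 with rfl | hf
    · exact Or.inl ⟨0, 1, one_ne_zero, by simp, by simp⟩
    rcases le_total f.totalDegree g.totalDegree with h | h
    · exact Or.inl ⟨f, g, hg0, rfl, h⟩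
    · exact Or.inr ⟨g, f, hf, inv_div _ _, h⟩

variable (L) in
-- Membership bounds the total degree of `f` by that of the denominator of `q`. Over a finite field,
-- in finitely many variables, only finitely many polynomials have bounded degree.
theorem finite_setOf_mul_mem_degreeValuationSubring [Finite σ] [Finite k] {q : L} (hq : q ≠ 0) :
    {f : MvPolynomial σ k |
      q * algebraMap _ L f ∈ degreeValuationSubring σ k L}.Finite := by
  have hinj := IsFractionRing.injective (MvPolynomial σ k) L
  obtain ⟨a, b, hb, rfl⟩ := IsFractionRing.div_surjective (A := MvPolynomial σ k) q
  have hb0 := nonZeroDivisors.ne_zero hb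
  have ha0 : a ≠ 0 := by rintro rfl; simp at hq
  have hfin : Finite (MvPolynomial.restrictTotalDegree σ k b.totalDegree) :=
    Module.finite_of_finite k
  refine Set.Finite.subset (s := (MvPolynomial.restrictTotalDegree σ k b.totalDegree :
    Set (MvPolynomial σ k))) (Set.toFinite _) ?_
  rintro f ⟨f', g', hg', h, hle⟩
  rw [SetLike.mem_coe, MvPolynomial.mem_restrictTotalDegree]
  rcases eq_or_ne f 0 with rfl | hf
  · simp
  have hb1 := (map_ne_zero_iff _ hinj).2 hb0
  have hg1 := (map_ne_zero_iff _ hinj).2 hg'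
  rw [div_mul_eq_mul_div, div_eq_div_iff hb1 hg1, ← map_mul, ← map_mul, ← map_mul] at h
  have h := hinj h
  have hf' : f' ≠ 0 := by
    rintro rfl
    rw [zero_mul] at h
    exact mul_ne_zero (mul_ne_zero ha0 hf) hg' h
  have hdeg := congrArg MvPolynomial.totalDegree h
  rw [MvPolynomial.totalDegree_mul_of_isDomain (mul_ne_zero ha0 hf) hg',
    MvPolynomial.totalDegree_mul_of_isDomain ha0 hf,
    MvPolynomial.totalDegree_mul_of_isDomain hf' hb0] at hdeg
  omega

end Degree

/-- The trace of `y * e` has bounded denominator over the polynomial ring and bounded pole at the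
degree valuation, so it takes finitely many values. Taking `e` through a basis determines `y`, since
the trace form of a separable extension is nondegenerate. -/
theorem finite_setOf_forall_valuation_le_of_isFractionRing {σ k L K : Type*} [Finite σ] [Field k]
    [Finite k] [Field L] [Algebra (MvPolynomial σ k) L] [IsFractionRing (MvPolynomial σ k) L]
    [Field K] [Algebra L K] [FiniteDimensional L K] [Algebra.IsSeparable L K] (U : Finset K) :
    {y : K | ∀ W : ValuationSubring K, ∃ u ∈ U, W.valuation y ≤ W.valuation u}.Finite := by
  classical
  have hinj := IsFractionRing.injective (MvPolynomial σ k) L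
  let _ : Algebra (MvPolynomial σ k) K := ((algebraMap L K).comp (algebraMap _ L)).toAlgebra
  have : IsScalarTower (MvPolynomial σ k) L K := .of_algebraMap_eq fun _ => rfl
  let _ : Algebra (degreeValuationSubring σ k L) K :=
    ((algebraMap L K).comp (algebraMap _ L)).toAlgebra
  have : IsScalarTower (degreeValuationSubring σ k L) L K := .of_algebraMap_eq fun _ => rfl
  set Y := {y : K | ∀ W : ValuationSubring K, ∃ u ∈ U, W.valuation y ≤ W.valuation u} with hY
  have key : ∀ e : K, ((fun y => Algebra.trace L K (y * e)) '' Y).Finite := by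
    intro e
    obtain ⟨d, hd0, hd⟩ := exists_mul_trace_mem_range (R := MvPolynomial σ k) (L := L)
      (U.image (· * e))
    obtain ⟨c, hc0, hc⟩ := exists_mul_trace_mem_range (R := degreeValuationSubring σ k L) (L := L)
      (U.image (· * e))
    have hd1 := (map_ne_zero_iff _ hinj).2 hd0
    have hc1 : (c : L) ≠ 0 := fun h => hc0 (Subtype.ext h)
    -- With `f` equal to `d` times the trace, the bound at the degree valuation says that `(c / d) *
    -- f` lies in its ring.
    refine ((finite_setOf_mul_mem_degreeValuationSubring (σ := σ) (k := k) L
      (div_ne_zero hc1 hd1)).image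
      fun f => algebraMap _ L f / algebraMap _ L d).subset ?_
    rintro _ ⟨y, hy, rfl⟩
    have hye : ∀ W : ValuationSubring K, ∃ u ∈ U.image (· * e),
        W.valuation (y * e) ≤ W.valuation u := by
      intro W
      obtain ⟨u, hu, hle⟩ := hy W
      refine ⟨u * e, Finset.mem_image_of_mem _ hu, ?_⟩
      rw [map_mul, map_mul]
      exact mul_le_mul_left hle _
    obtain ⟨f, hf⟩ := hd _ hye
    obtain ⟨r, hr⟩ := hc _ hye
    refine ⟨f, ?_, ?_⟩
    · change (c : L) / algebraMap _ L d * algebraMap _ L f ∈ degreeValuationSubring σ k L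
      have : (c : L) / algebraMap _ L d * algebraMap _ L f = r := by
        rw [hf, div_mul_eq_mul_div, mul_left_comm, mul_div_cancel_left₀ _ hd1]
        exact hr.symm
      rw [this]
      exact r.2
    · change algebraMap _ L f / algebraMap _ L d = _
      rw [hf, mul_div_cancel_left₀ _ hd1]
  let b := Module.finBasis L K
  have hfin : (Set.pi Set.univ fun i => (fun y => Algebra.trace L K (y * b i)) '' Y).Finite :=
    Set.Finite.pi fun i => key (b i)
  refine Set.Finite.of_finite_image (f := fun y i => Algebra.trace L K (y * b i))
    (hfin.subset ?_) ?_
  · rintro _ ⟨y, hy, rfl⟩ i -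
    exact ⟨y, hy, rfl⟩
  · intro y _ z _ h
    rw [← sub_eq_zero]
    refine (traceForm_nondegenerate L K).1 _ fun w => ?_
    have : Algebra.traceForm L K (y - z) = 0 := b.ext fun i => by
      have := congrFun h i
      simp only at this
      simp [Algebra.traceForm_apply, this]
    rw [this]; rfl

open scoped IntermediateField.algebraAdjoinAdjoin in
/-- A finitely generated field over a finite field has only finitely many elements whose absolute
values are all bounded by those of finitely many given elements. -/
theorem finite_setOf_forall_valuation_le (k : Type*) {K : Type*} [Field k] [Finite k] [Field K]
    [Algebra k K] [Algebra.EssFiniteType k K] (U : Finset K) :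
    {y : K | ∀ W : ValuationSubring K, ∃ u ∈ U, W.valuation y ≤ W.valuation u}.Finite := by
  obtain ⟨s, hs, hsep⟩ := exists_isTranscendenceBasis_and_isSeparable_of_perfectField k K
  have hr : Set.range ((↑) : s → K) = (s : Set K) := by simp
  let L := IntermediateField.adjoin k (s : Set K)
  have e : MvPolynomial s k ≃ₐ[k] Algebra.adjoin k (s : Set K) :=
    hs.1.aevalEquiv.trans (Subalgebra.equivOfEq _ _ (by rw [hr]))
  let _ : Algebra (MvPolynomial s k) L :=
    ((algebraMap (Algebra.adjoin k (s : Set K)) L).comp e.toRingEquiv.toRingHom).toAlgebra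
  have : IsFractionRing (MvPolynomial s k) L := by
    have := IsLocalization.isLocalization_of_base_ringEquiv (nonZeroDivisors _) L
      e.toRingEquiv.symm (R := Algebra.adjoin k (s : Set K))
    rw [MulEquivClass.map_nonZeroDivisors] at this
    exact this
  have : Algebra.EssFiniteType L K := .of_comp k L K
  have : FiniteDimensional L K := by
    obtain ⟨t, ht⟩ := IntermediateField.fg_top L K
    have := IntermediateField.finiteDimensional_adjoin (K := L) (S := (t : Set K))
      fun x _ => Algebra.IsIntegral.isIntegral x
    rw [ht] at this
    exact IntermediateField.topEquiv.toLinearEquiv.finiteDimensional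
  exact finite_setOf_forall_valuation_le_of_isFractionRing (σ := s) (k := k) (L := L) U

end ValuationBound

/-! ### Heights of primes and affine models of finitely generated fields. -/

namespace FieldModel

open scoped IntermediateField.algebraAdjoinAdjoin

/-- By prime avoidance, some `h ∈ m` lies in neither `⊥` nor any minimal prime over `s`, as these
have height at most one. A minimal prime over `h` inside `m` has height one by Krull. It cannot
contain `s`, since a minimal prime over `s` inside it would either contain `h` or be zero. -/
theorem exists_height_eq_one_notMem {R : Type*} [CommRing R] [IsDomain R] [IsNoetherianRing R]
    {m : Ideal R} [m.IsPrime] (hm : 2 ≤ m.height) {s : R} (hs : s ≠ 0) :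
    ∃ P : Ideal R, P.IsPrime ∧ P ≤ m ∧ P.height = 1 ∧ s ∉ P := by
  have hfin := (Ideal.finite_minimalPrimes_of_isNoetherianRing R (Ideal.span {s})).insert ⊥
  have havoid : ¬ (m : Set R) ⊆ ⋃ q ∈ insert ⊥ (Ideal.span {s}).minimalPrimes, (q : Set R) := by
    intro hsub
    obtain ⟨q, hq, hle⟩ := (Ideal.subset_union_prime_finite hfin ⊥ ⊥ (by
      rintro q (rfl | hq) _ _
      exacts [Ideal.isPrime_bot, hq.1.1])).1 hsub
    have h1 : q.height ≤ 1 := by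
      rcases hq with rfl | hq
      · simp
      · exact Ideal.height_le_one_of_isPrincipal_of_mem_minimalPrimes _ q hq
    exact absurd ((hm.trans (Ideal.height_mono hle)).trans h1) (by norm_num)
  obtain ⟨h, hhm, hh⟩ := Set.not_subset.1 havoid
  simp only [Set.mem_iUnion, not_exists] at hh
  obtain ⟨P, hP, hPm⟩ := Ideal.exists_minimalPrimes_le (I := Ideal.span {h}) (J := m)
    ((Ideal.span_singleton_le_iff_mem _).2 hhm)
  have hPprime : P.IsPrime := hP.1.1
  have hhP : h ∈ P := (Ideal.span_singleton_le_iff_mem _).1 hP.1.2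
  have hP1 : P.height ≤ 1 := Ideal.height_le_one_of_isPrincipal_of_mem_minimalPrimes _ P hP
  have hsP : s ∉ P := by
    intro hsP
    obtain ⟨q, hq, hqP⟩ := Ideal.exists_minimalPrimes_le (I := Ideal.span {s}) (J := P)
      ((Ideal.span_singleton_le_iff_mem _).2 hsP)
    have hqprime : q.IsPrime := hq.1.1
    rcases hqP.eq_or_lt with rfl | hlt
    · exact hh q (Set.mem_insert_of_mem _ hq) hhP
    · have h1 := (Ideal.height_add_one_le_of_lt_of_isPrime hlt).trans hP1
      have h0 : q.height = 0 := by
        have : q.height + 1 ≤ 0 + 1 := by simpa using h1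
        simpa using (ENat.add_le_add_iff_right ENat.one_ne_top).1 this
      rw [Ideal.height_eq_zero_iff_eq_bot] at h0
      exact hs (by simpa [h0] using hq.1.2 (Ideal.mem_span_singleton_self s))
  refine ⟨P, hPprime, hPm, le_antisymm hP1 (Order.one_le_iff_ne_zero.2 fun h0 => ?_), hsP⟩
  rw [Ideal.height_eq_zero_iff_eq_bot] at h0
  exact hh ⊥ (Set.mem_insert _ _) (h0 ▸ hhP)

/-- Over a Jacobson ring a maximal ideal of a polynomial ring contracts to a maximal ideal of the
coefficients, and each variable adds one to the height. -/
theorem height_eq_of_isMaximal_mvPolynomial (k : Type*) [Field k] (n : ℕ) :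
    ∀ (m : Ideal (MvPolynomial (Fin n) k)) [m.IsMaximal], m.height = n := by
  induction n with
  | zero =>
    intro m hm
    have h := Ideal.height_le_ringKrullDim_of_ne_top hm.ne_top
    rw [MvPolynomial.ringKrullDim_of_isNoetherianRing, ringKrullDim_eq_zero_of_field] at h
    simpa using h
  | succ n ih =>
    intro m hm
    let e := (MvPolynomial.finSuccEquiv k n).toRingEquiv
    have hmax : (m.map e).IsMaximal := Ideal.map_isMaximal_of_equiv e
    have hmax' := Polynomial.isMaximal_comap_C_of_isJacobsonRing (m.map e)
    have hover : (m.map e).LiesOver ((m.map e).comap Polynomial.C) := ⟨rfl⟩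
    rw [← e.height_map m,
      Polynomial.height_eq_height_add_one ((m.map e).comap Polynomial.C) (m.map e), ih]
    simp

/-- Noether normalization makes `B` integral over a polynomial ring in `n ≥ 2` variables. Going down
over this normal ring gives `m` at least the height of its contraction, which is `n`. -/
theorem two_le_height_of_isMaximal (k : Type*) {B : Type*} [Field k] [CommRing B] [IsDomain B]
    [Algebra k B] [Algebra.FiniteType k B] (htr : 2 ≤ Algebra.trdeg k B) (m : Ideal B)
    [m.IsMaximal] : 2 ≤ m.height := by
  obtain ⟨n, f, hinj, hint⟩ := exists_integral_inj_algHom_of_fg k B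
  let _ : Algebra (MvPolynomial (Fin n) k) B := f.toRingHom.toAlgebra
  have : IsScalarTower k (MvPolynomial (Fin n) k) B := .of_algebraMap_eq fun x => (f.commutes x).symm
  have : Algebra.IsIntegral (MvPolynomial (Fin n) k) B := ⟨hint⟩
  have : FaithfulSMul (MvPolynomial (Fin n) k) B := (faithfulSMul_iff_algebraMap_injective _ _).2 hinj
  have hn : 2 ≤ n := by
    have h := lift_trdeg_add_eq k (MvPolynomial (Fin n) k) B
    rw [(trdeg_eq_zero_iff (R := MvPolynomial (Fin n) k) (A := B)).2 inferInstance,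
      MvPolynomial.trdeg_of_isDomain] at h
    have h2 := Cardinal.lift_le.2 htr
    rw [← h] at h2
    simpa using h2
  have hB : IsNoetherianRing B := Algebra.FiniteType.isNoetherianRing k B
  have hmax : (m.under (MvPolynomial (Fin n) k)).IsMaximal :=
    Ideal.isMaximal_comap_of_isIntegral_of_isMaximal m
  rw [Ideal.height_eq_height_add_of_liesOver_of_hasGoingDown (m.under (MvPolynomial (Fin n) k)) m,
    height_eq_of_isMaximal_mvPolynomial]
  exact le_add_right (by exact_mod_cast hn)

/-- A finitely generated extension of a perfect field is the fraction field of an integrally closed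
finitely generated algebra. -/
theorem exists_isIntegrallyClosed_model (k K : Type*) [Field k] [PerfectField k] [Field K]
    [Algebra k K] [Algebra.EssFiniteType k K] :
    ∃ C : Subalgebra k K, C.FG ∧ (∀ x : K, IsIntegral C x → x ∈ C) ∧
      ∀ x : K, ∃ a ∈ C, ∃ b ∈ C, b ≠ 0 ∧ x = a / b := by
  obtain ⟨s, hs, hsep⟩ := exists_isTranscendenceBasis_and_isSeparable_of_perfectField k K
  have hr : Set.range ((↑) : s → K) = (s : Set K) := by simp
  let D := Algebra.adjoin k (s : Set K)
  let L := IntermediateField.adjoin k (s : Set K)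
  have e : MvPolynomial s k ≃ₐ[k] D :=
    hs.1.aevalEquiv.trans (Subalgebra.equivOfEq _ _ (by rw [hr]))
  have hDic : IsIntegrallyClosed D := .of_equiv e.toRingEquiv
  have hDft : Algebra.FiniteType k D := .adjoin_of_finite s.finite_toSet
  have hDnoe : IsNoetherianRing D := Algebra.FiniteType.isNoetherianRing k D
  have : Algebra.EssFiniteType L K := .of_comp k L K
  have : FiniteDimensional L K := by
    obtain ⟨t, ht⟩ := IntermediateField.fg_top L K
    have := IntermediateField.finiteDimensional_adjoin (K := L) (S := (t : Set K))
      fun x _ => Algebra.IsIntegral.isIntegral x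
    rw [ht] at this
    exact IntermediateField.topEquiv.toLinearEquiv.finiteDimensional
  have hfin : Module.Finite D (integralClosure D K) := IsIntegralClosure.finite D L K _
  have hft : Algebra.FiniteType k (integralClosure D K) := .trans hDft inferInstance
  have hfrac : IsFractionRing (integralClosure D K) K :=
    IsIntegralClosure.isFractionRing_of_finite_extension D L K _
  refine ⟨(integralClosure D K).restrictScalars k, ?_, ?_, ?_⟩
  · exact (Subalgebra.fg_iff_finiteType _).2 hft
  · intro x hx
    have hx' : IsIntegral (integralClosure D K) x := hx
    exact isIntegral_trans (R := D) x hx'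
  · intro x
    obtain ⟨a, b, hb, rfl⟩ := IsFractionRing.div_surjective (A := integralClosure D K) x
    exact ⟨a, a.2, b, b.2, fun h => nonZeroDivisors.ne_zero hb (Subtype.ext h), rfl⟩

/-- For each field generator, either it or its inverse lies in `W`; replacing generators by inverses
does not change the field generated. -/
theorem exists_finset_subset_valuationSubring (k : Type*) {K : Type*} [Field k] [Field K]
    [Algebra k K] [Algebra.EssFiniteType k K] (W : ValuationSubring K) (Z : Finset K)
    (hZ : ∀ z ∈ Z, z ∈ W) :
    ∃ G : Finset K, Z ⊆ G ∧ (∀ g ∈ G, g ∈ W) ∧ ∀ x : K, ∃ a ∈ Algebra.adjoin k (G : Set K),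
      ∃ b ∈ Algebra.adjoin k (G : Set K), b ≠ 0 ∧ x = a / b := by
  classical
  obtain ⟨T, hT⟩ := IntermediateField.fg_top k K
  refine ⟨Z ∪ T.image fun t => if t ∈ W then t else t⁻¹, Finset.subset_union_left, ?_, ?_⟩
  · intro g hg
    rcases Finset.mem_union.1 hg with hg | hg
    · exact hZ g hg
    · obtain ⟨t, -, rfl⟩ := Finset.mem_image.1 hg
      split_ifs with h
      · exact h
      · exact (W.mem_or_inv_mem t).resolve_left h
  · set G := Z ∪ T.image fun t => if t ∈ W then t else t⁻¹
    intro x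
    have htop : IntermediateField.adjoin k (G : Set K) = ⊤ := by
      rw [eq_top_iff, ← hT, IntermediateField.adjoin_le_iff]
      intro t ht
      have hmem : (if t ∈ W then t else t⁻¹) ∈ IntermediateField.adjoin k (G : Set K) :=
        IntermediateField.subset_adjoin k _ (Finset.mem_coe.2
          (Finset.mem_union_right _ (Finset.mem_image_of_mem _ ht)))
      split_ifs at hmem
      · exact hmem
      · exact inv_mem_iff.1 hmem
    have hx : x ∈ IntermediateField.adjoin k (G : Set K) := htop ▸ IntermediateField.mem_top
    obtain ⟨a, ha, b, hb, rfl⟩ := IntermediateField.mem_adjoin_iff_div.1 hx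
    rcases eq_or_ne b 0 with rfl | hb0
    · exact ⟨0, zero_mem _, 1, one_mem _, one_ne_zero, by simp⟩
    · exact ⟨a, ha, b, hb, hb0, rfl⟩

end FieldModel

/-! ### Comparing localizations of different models inside the field. -/

namespace FieldModel

open IsLocalRing

variable {k K : Type*} [Field k] [Field K] [Algebra k K]

/-- Fractions over `A` whose denominators are inverted in `O` form a subalgebra, so the generators
of the other model suffice. This lets one local ring be viewed as a localization of several models.
-/
theorem exists_div_of_forall_generator {A : Subalgebra k K} {O : Subring K} {G : Set K}
    (hG : ∀ g ∈ G, ∃ a ∈ A, ∃ d ∈ A, d ≠ 0 ∧ d⁻¹ ∈ O ∧ g = a / d) {b c : K}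
    (hb : b ∈ Algebra.adjoin k G) (hc : c ∈ Algebra.adjoin k G) (hc0 : c ≠ 0) (hcO : c⁻¹ ∈ O) :
    ∃ a ∈ A, ∃ d ∈ A, d ≠ 0 ∧ d⁻¹ ∈ O ∧ b / c = a / d := by
  let T : Subalgebra k K :=
    { carrier := {x | ∃ a ∈ A, ∃ d ∈ A, d ≠ 0 ∧ d⁻¹ ∈ O ∧ x = a / d}
      mul_mem' := by
        rintro _ _ ⟨a, ha, d, hd, hd0, hdO, rfl⟩ ⟨a', ha', d', hd', hd0', hdO', rfl⟩
        exact ⟨a * a', mul_mem ha ha', d * d', mul_mem hd hd', mul_ne_zero hd0 hd0',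
          by rw [mul_inv]; exact mul_mem hdO hdO', div_mul_div_comm _ _ _ _⟩
      add_mem' := by
        rintro _ _ ⟨a, ha, d, hd, hd0, hdO, rfl⟩ ⟨a', ha', d', hd', hd0', hdO', rfl⟩
        exact ⟨a * d' + d * a', add_mem (mul_mem ha hd') (mul_mem hd ha'), d * d', mul_mem hd hd',
          mul_ne_zero hd0 hd0', by rw [mul_inv]; exact mul_mem hdO hdO', div_add_div _ _ hd0 hd0'⟩
      algebraMap_mem' := fun r => ⟨_, A.algebraMap_mem r, 1, one_mem _, one_ne_zero,
        by simp [one_mem], by simp⟩ }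
  have hle : Algebra.adjoin k G ≤ T := Algebra.adjoin_le hG
  obtain ⟨a, ha, d, hd, hd0, hdO, rfl⟩ := hle hb
  obtain ⟨a', ha', d', hd', hd0', hdO', rfl⟩ := hle hc
  have ha0 : a' ≠ 0 := by rintro rfl; simp at hc0
  refine ⟨a * d', mul_mem ha hd', d * a', mul_mem hd ha', mul_ne_zero hd0 ha0, ?_,
    div_div_div_eq _ _ _ _⟩
  rw [inv_div] at hcO
  have : (d * a')⁻¹ = d⁻¹ * (d'⁻¹ * (d' / a')) := by
    rw [mul_inv, div_eq_mul_inv, inv_mul_cancel_left₀ hd0']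
  rw [this]
  exact mul_mem hdO (mul_mem hdO' hcO)

theorem mem_ofPrime_iff {B : Subring K} {P : Ideal B} [P.IsPrime] {x : K} :
    x ∈ (LocalSubring.ofPrime B P).toSubring ↔ ∃ b d : B, d ∉ P ∧ x = b / d := by
  constructor
  · intro hx
    obtain ⟨⟨b, d⟩, h⟩ := IsLocalization.surj P.primeCompl
      (⟨x, hx⟩ : (LocalSubring.ofPrime B P).toSubring)
    have hd0 : ((d : B) : K) ≠ 0 := fun h0 => d.2 (by
      rw [show (d : B) = 0 from Subtype.ext h0]; exact P.zero_mem)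
    exact ⟨b, d, d.2, (eq_div_iff hd0).2 (congrArg Subtype.val h)⟩
  · rintro ⟨b, d, hd, rfl⟩
    have hu := IsLocalization.map_units (LocalSubring.ofPrime B P).toSubring
      (⟨d, hd⟩ : P.primeCompl)
    obtain ⟨u, hu⟩ := hu
    have h1 : ((u : (LocalSubring.ofPrime B P).toSubring) : K) = d := congrArg Subtype.val hu
    have h2 : (d : K)⁻¹ = ((u⁻¹ : (LocalSubring.ofPrime B P).toSubringˣ) :
        (LocalSubring.ofPrime B P).toSubring) := by
      rw [← h1]
      refine inv_eq_of_mul_eq_one_right ?_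
      exact congrArg Subtype.val (Units.mul_inv u)
    rw [div_eq_mul_inv, h2]
    exact mul_mem (LocalSubring.le_ofPrime B P b.2) (Subtype.property _)

/-- `O` is the localization of the normal domain `C` at the elements of `C` that are invertible in
`O`. -/
theorem isIntegrallyClosed_of_forall_exists_div {C : Subalgebra k K} {O : Subring K}
    (hC : ∀ x : K, IsIntegral C x → x ∈ C) (hCfrac : ∀ x : K, ∃ a ∈ C, ∃ b ∈ C, b ≠ 0 ∧ x = a / b)
    (hCO : ∀ x ∈ C, x ∈ O)
    (hO : ∀ x ∈ O, ∃ a ∈ C, ∃ d ∈ C, d ≠ 0 ∧ d⁻¹ ∈ O ∧ x = a / d) : IsIntegrallyClosed O := by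
  have : IsFractionRing C K := IsFractionRing.of_field _ _ fun x => by
    obtain ⟨a, ha, b, hb, -, rfl⟩ := hCfrac x
    exact ⟨⟨a, ha⟩, ⟨b, hb⟩, rfl⟩
  have : IsIntegrallyClosed C := (isIntegrallyClosed_iff K).2 fun {x} hx => ⟨⟨x, hC x hx⟩, rfl⟩
  let _ : Algebra C O := (Subring.inclusion (R := K) (S := C.toSubring) (T := O) hCO).toAlgebra
  let M : Submonoid C :=
    { carrier := {c | (c : K) ≠ 0 ∧ (c : K)⁻¹ ∈ O}
      mul_mem' := fun {a b} ha hb => ⟨mul_ne_zero ha.1 hb.1, by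
        change ((a : K) * b)⁻¹ ∈ O
        rw [mul_inv]; exact mul_mem ha.2 hb.2⟩
      one_mem' := ⟨one_ne_zero, by simp [one_mem]⟩ }
  have : IsLocalization M O :=
    { map_units := fun c => IsUnit.of_mul_eq_one ⟨_, c.2.2⟩ (Subtype.ext (mul_inv_cancel₀ c.2.1))
      surj := fun x => by
        obtain ⟨a, ha, d, hd, hd0, hdO, hx⟩ := hO x x.2
        exact ⟨⟨⟨a, ha⟩, ⟨⟨d, hd⟩, hd0, hdO⟩⟩, Subtype.ext ((eq_div_iff hd0).1 hx)⟩
      exists_of_eq := fun {x y} h => ⟨1, by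
        have : (x : K) = y := congrArg (fun z : O => (z : K)) h
        rw [Subtype.ext this]⟩ }
  exact isIntegrallyClosed_of_isLocalization O M fun c hc =>
    mem_nonZeroDivisors_of_ne_zero fun h => hc.1 (congrArg Subtype.val h)

end FieldModel

/-! ### Divisorial valuation rings near an arbitrary valuation ring. -/

namespace FieldModel

open IsLocalRing

variable {k K : Type*} [Field k] [Field K] [Algebra k K]

/-- Avoiding the single element `q(σ)` keeps `P` from meeting `k[σ]` nontrivially. A nonzero
contraction of `P` to `k[X]` would be maximal, hence equal to that of `m`, which contains `q`. If
`m` contracts to zero, so does `P`. -/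
theorem aeval_notMem_of_aeval_notMem {B : Type*} [CommRing B] [Algebra k B] (σ : B)
    {m P : Ideal B} [m.IsPrime] [P.IsPrime] (hPm : P ≤ m) {q : k[X]}
    (hq : aeval σ q ∉ P) (hqm : aeval σ q ∈ m ∨ ∀ f : k[X], aeval σ f ∈ m → f = 0) {f : k[X]}
    (hf : f ≠ 0) : aeval σ f ∉ P := by
  intro hfP
  rcases hqm with hqm | hm
  · have hPX : (P.comap (aeval σ : k[X] →ₐ[k] B)).IsPrime := Ideal.comap_isPrime _ _
    have hbot : P.comap (aeval σ : k[X] →ₐ[k] B) ≠ ⊥ := fun h => hf (by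
      have : f ∈ P.comap (aeval σ : k[X] →ₐ[k] B) := hfP
      simpa [h] using this)
    have hmax := hPX.isMaximal hbot
    have heq := hmax.eq_of_le (J := m.comap (aeval σ : k[X] →ₐ[k] B))
      (Ideal.comap_isPrime _ _).ne_top (Ideal.comap_mono hPm)
    have : q ∈ P.comap (aeval σ : k[X] →ₐ[k] B) := heq ▸ hqm
    exact hq this
  · exact hf (hm f (hPm hfP))

theorem exists_aeval_mem {B : Type*} [CommRing B] [Algebra k B] (σ : B) (m : Ideal B) :
    ∃ q : k[X], q ≠ 0 ∧ (aeval σ q ∈ m ∨ ∀ f : k[X], aeval σ f ∈ m → f = 0) := by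
  by_cases h : ∃ q : k[X], q ≠ 0 ∧ aeval σ q ∈ m
  · obtain ⟨q, hq, hqm⟩ := h
    exact ⟨q, hq, Or.inl hqm⟩
  · push Not at h
    exact ⟨1, one_ne_zero, Or.inr fun f hf => by_contra fun hf0 => h f hf0 hf⟩

/-- Let `W` be a valuation ring of a finitely generated field `K` of transcendence degree at least
two, and let `Z` be a finite subset of its maximal ideal. Then there is a divisorial valuation ring
`O` of `K` containing a local ring in whose maximal ideal `Z` lies. Moreover, `O` may be chosen
trivial on `k(τ)`, a localization of a given algebra, and such that finitely many given nonzero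
elements are units. -/
theorem exists_valuationSubring [PerfectField k] [Algebra.EssFiniteType k K]
    (htr : 2 ≤ Algebra.trdeg k K) {τ : K} (hτ : Transcendental k τ) (A : Subalgebra k K)
    (hA : ∀ x : K, ∃ a ∈ A, ∃ b ∈ A, b ≠ 0 ∧ x = a / b) (H : Finset K)
    (hHA : ∀ O : Subring K, (∀ x ∈ IntermediateField.adjoin k {τ}, x ∈ O) → (∀ h ∈ H, h ∈ O) →
      ∀ a ∈ A, a ∈ O)
    (W : ValuationSubring K) (hkW : ∀ c, algebraMap k K c ∈ W) (Z : Finset K) (hZ : ∀ z ∈ Z, W.valuation z < 1) (E : Finset K) :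
    ∃ (O : ValuationSubring K) (R : LocalSubring K), R.toSubring ≤ O.toSubring ∧
      (∀ z ∈ Z, ∃ h : z ∈ R.toSubring, (⟨z, h⟩ : R.toSubring) ∈ maximalIdeal R.toSubring) ∧
      (∀ e ∈ E, e ≠ 0 → e ∈ O ∧ e⁻¹ ∈ O) ∧ ringKrullDim O = 1 ∧ (∀ a ∈ A, a ∈ O) ∧
      ∀ x ∈ O, ∃ a ∈ A, ∃ d ∈ A, d ≠ 0 ∧ d⁻¹ ∈ O ∧ x = a / d := by
  classical
  -- `B` need not be normal; the normal model `C` is there to make the local ring at `P` integrally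
  -- closed.
  obtain ⟨C, ⟨HC, hHC⟩, hCint, hCfrac⟩ := exists_isIntegrallyClosed_model k K
  obtain ⟨σ, hσ, hσW⟩ : ∃ σ : K, (σ = τ ∨ σ = τ⁻¹) ∧ σ ∈ W := by
    rcases W.mem_or_inv_mem τ with h | h
    exacts [⟨τ, Or.inl rfl, h⟩, ⟨τ⁻¹, Or.inr rfl, h⟩]
  obtain ⟨G, hZG, hGW, hGfrac⟩ := exists_finset_subset_valuationSubring k W (insert σ Z) (by
    intro z hz
    rcases Finset.mem_insert.1 hz with rfl | hz
    · exact hσW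
    · exact (W.valuation_le_one_iff z).1 (hZ z hz).le)
  let B := (Algebra.adjoin k (G : Set K)).toSubring
  let _ : Algebra k B := inferInstanceAs (Algebra k (Algebra.adjoin k (G : Set K)))
  have hft : Algebra.FiniteType k B :=
    (.adjoin_of_finite G.finite_toSet : Algebra.FiniteType k (Algebra.adjoin k (G : Set K)))
  have hBnoe : IsNoetherianRing B := Algebra.FiniteType.isNoetherianRing k B
  have hBfrac : IsFractionRing B K := IsFractionRing.of_field _ _ fun x => by
    obtain ⟨a, ha, b, hb, -, rfl⟩ := hGfrac x
    exact ⟨⟨a, ha⟩, ⟨b, hb⟩, rfl⟩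
  have htower : IsScalarTower k B K := .of_algebraMap_eq fun _ => rfl
  have hBtr : 2 ≤ Algebra.trdeg k B := by
    have halg : Algebra.IsAlgebraic B K := IsLocalization.isAlgebraic _ (nonZeroDivisors B)
    rw [← trdeg_add_eq k B (A := K), (trdeg_eq_zero_iff (R := B) (A := K)).2 halg, add_zero] at htr
    exact htr
  have hBW : ∀ b ∈ B, b ∈ W := fun b hb => Algebra.adjoin_induction (p := fun x _ => x ∈ W)
    hGW hkW (fun _ _ _ _ => add_mem) (fun _ _ _ _ => mul_mem) hb
  let ι : B →+* W := Subring.inclusion (R := K) (S := B) (T := W.toSubring) hBW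
  have hprime : ((maximalIdeal W).comap ι).IsPrime := Ideal.comap_isPrime _ _
  -- The centre of `W` on `B` may have small height, so it is enlarged to a maximal ideal; `Z` stays
  -- inside.
  obtain ⟨m, hm, hmle⟩ := Ideal.exists_le_maximal _ hprime.ne_top
  have hσG : σ ∈ B := Algebra.subset_adjoin (hZG (Finset.mem_insert_self _ _))
  obtain ⟨q, hq0, hq⟩ := exists_aeval_mem (k := k) (⟨σ, hσG⟩ : B) m
  have hval : ∀ f : k[X], ((aeval (⟨σ, hσG⟩ : B) f : B) : K) = aeval σ f := fun f =>
    (Polynomial.aeval_algebraMap_apply K (⟨σ, hσG⟩ : B) f).symm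
  have hσtr : ∀ f : k[X], f ≠ 0 → aeval (⟨σ, hσG⟩ : B) f ≠ 0 := by
    intro f hf h0
    have hσ' : Transcendental k σ := by
      rcases hσ with rfl | rfl
      · exact hτ
      · exact fun h => hτ (IsAlgebraic.inv_iff.1 h)
    refine hσ' ⟨f, hf, ?_⟩
    rw [← hval, h0]; rfl
  have hnd : ∀ x : K, ∃ b d : B, b ≠ 0 ∧ d ≠ 0 ∧ (x ≠ 0 → x = b / d) := by
    intro x
    rcases eq_or_ne x 0 with rfl | hx
    · exact ⟨1, 1, one_ne_zero, one_ne_zero, fun h => absurd rfl h⟩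
    · obtain ⟨a, ha, b, hb, hb0, rfl⟩ := hGfrac x
      refine ⟨⟨a, ha⟩, ⟨b, hb⟩, fun h => hx ?_, fun h => hb0 (congrArg Subtype.val h), fun _ => rfl⟩
      rw [show a = 0 from congrArg Subtype.val h, zero_div]
  choose num den hnum hden hnd using hnd
  choose nA hnA dA hdA hdA0 hxA using hA
  choose nC hnC dC hdC hdC0 hxC using hCfrac
  -- Nonzero elements of `N` become units at `P`. `H` and `HC` put `A` and `C` inside the local
  -- ring; the denominators `dA` and `dC` of the generators of `B` make it a localization of `A` and
  -- of `C`.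
  let N : Finset K := E ∪ H ∪ HC ∪ G.image nA ∪ G.image dA ∪ G.image nC ∪ G.image dC
  obtain ⟨P, hP, hPm, hPh, hsP⟩ := exists_height_eq_one_notMem
    (two_le_height_of_isMaximal k hBtr m)
    (s := aeval (⟨σ, hσG⟩ : B) q * ∏ x ∈ N, (num x * den x))
    (mul_ne_zero (hσtr q hq0) (Finset.prod_ne_zero_iff.2 fun x _ => mul_ne_zero (hnum x) (hden x)))
  have hqP : aeval (⟨σ, hσG⟩ : B) q ∉ P := fun h => hsP (P.mul_mem_right _ h)
  have hnumP : ∀ x ∈ N, num x ∉ P ∧ den x ∉ P := by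
    intro x hx
    have : num x * den x ∉ P := fun h => hsP (P.mul_mem_left _ (by
      rw [← Finset.mul_prod_erase _ _ hx]
      exact P.mul_mem_right _ h))
    exact ⟨fun h => this (P.mul_mem_right _ h), fun h => this (P.mul_mem_left _ h)⟩
  let O' := LocalSubring.ofPrime B P
  have hBO : ∀ b ∈ B, b ∈ O'.toSubring := fun b hb => LocalSubring.le_ofPrime B P hb
  have hunit : ∀ x ∈ N, x ≠ 0 → x ∈ O'.toSubring ∧ x⁻¹ ∈ O'.toSubring := by
    intro x hx hx0
    rw [mem_ofPrime_iff, mem_ofPrime_iff]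
    exact ⟨⟨_, _, (hnumP x hx).2, hnd x hx0⟩, ⟨_, _, (hnumP x hx).1, by
      rw [← inv_div, ← hnd x hx0]⟩⟩
  have hNO : ∀ x ∈ N, x ∈ O'.toSubring := by
    intro x hx
    rcases eq_or_ne x 0 with rfl | hx0
    · exact zero_mem _
    · exact (hunit x hx hx0).1
  have hτO : ∀ x ∈ IntermediateField.adjoin k {τ}, x ∈ O'.toSubring := by
    intro x hx
    have hx' : x ∈ IntermediateField.adjoin k {σ} := by
      refine IntermediateField.adjoin_simple_le_iff.2 ?_ hx
      have := IntermediateField.mem_adjoin_simple_self k σ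
      rcases hσ with rfl | rfl
      · exact this
      · exact inv_mem_iff.1 this
    obtain ⟨f, h, rfl⟩ := (IntermediateField.mem_adjoin_simple_iff k x).1 hx'
    rcases eq_or_ne h 0 with rfl | hh
    · simp [zero_mem]
    · exact mem_ofPrime_iff.2 ⟨aeval ⟨σ, hσG⟩ f, aeval ⟨σ, hσG⟩ h, aeval_notMem_of_aeval_notMem _ hPm hqP hq hh, by
        rw [hval, hval]⟩
  have hAO : ∀ a ∈ A, a ∈ O'.toSubring := hHA _ hτO fun h hh => hNO h (by simp [N, hh])
  have hCO : ∀ c ∈ C, c ∈ O'.toSubring := by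
    intro c hc
    rw [← hHC] at hc
    exact Algebra.adjoin_induction (p := fun x _ => x ∈ O'.toSubring)
      (fun c hc => hNO c (by simp only [N, Finset.mem_union, Finset.mem_coe.1 hc]; tauto))
      (fun r => hBO _ (Subalgebra.algebraMap_mem _ r))
      (fun _ _ _ _ => add_mem) (fun _ _ _ _ => mul_mem) hc
  have hloc : ∀ (D : Subalgebra k K) (n d : K → K), (∀ x, n x ∈ D) → (∀ x, d x ∈ D) →
      (∀ x, d x ≠ 0) → (∀ x, x = n x / d x) → (∀ g ∈ G, d g ∈ N) →
      ∀ x ∈ O'.toSubring, ∃ a ∈ D, ∃ b ∈ D, b ≠ 0 ∧ b⁻¹ ∈ O'.toSubring ∧ x = a / b := by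
    intro D n d hn hd hd0 hx hN x hxO
    obtain ⟨b, c, hc, rfl⟩ := mem_ofPrime_iff.1 hxO
    have hc0 : (c : K) ≠ 0 := fun h => hc (by
      rw [show c = 0 from Subtype.ext h]; exact P.zero_mem)
    have hgen : ∀ g ∈ (G : Set K), ∃ a ∈ D, ∃ b ∈ D, b ≠ 0 ∧ b⁻¹ ∈ O'.toSubring ∧ g = a / b :=
      fun g hg => ⟨n g, hn g, d g, hd g, hd0 g, (hunit _ (hN g hg) (hd0 g)).2, hx g⟩
    exact exists_div_of_forall_generator hgen b.2 c.2 hc0 (mem_ofPrime_iff.2 ⟨1, c, hc, by simp⟩)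
  have hic : IsIntegrallyClosed O'.toSubring :=
    isIntegrallyClosed_of_forall_exists_div hCint
      (fun x => ⟨nC x, hnC x, dC x, hdC x, hdC0 x, hxC x⟩) hCO
      (hloc C nC dC hnC hdC hdC0 hxC fun g hg => by
        simp only [N, Finset.mem_union]; exact Or.inr (Finset.mem_image_of_mem _ hg))
  have hdim : ringKrullDim O'.toSubring = 1 := by
    rw [IsLocalization.AtPrime.ringKrullDim_eq_height P O'.toSubring, hPh]; rfl
  have hfrac : IsFractionRing O'.toSubring K := IsFractionRing.of_field _ _ fun x => by
    obtain ⟨a, ha, b, hb, -, rfl⟩ := hGfrac x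
    exact ⟨⟨a, hBO _ ha⟩, ⟨b, hBO _ hb⟩, rfl⟩
  have hval : ValuationRing O'.toSubring := by
    have : IsNoetherianRing O'.toSubring := IsLocalization.isNoetherianRing P.primeCompl _ hBnoe
    -- A Noetherian local domain that is normal and whose only nonzero prime is the maximal ideal is
    -- a valuation ring.
    have htfae : ValuationRing O'.toSubring ↔ IsIntegrallyClosed O'.toSubring ∧
        ∀ Q : Ideal O'.toSubring, Q ≠ ⊥ → Q.IsPrime → Q = maximalIdeal O'.toSubring :=
      (tfae_of_isNoetherianRing_of_isLocalRing_of_isDomain O'.toSubring).out 1 3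
    refine htfae.2 ⟨hic, fun Q hQ hQp => ?_⟩
    have : Ring.KrullDimLE 1 O'.toSubring := Ring.krullDimLE_iff.2 hdim.le
    exact eq_maximalIdeal (Ring.krullDimLE_one_iff_of_noZeroDivisors.1 this Q hQ hQp)
  let O : ValuationSubring K :=
    { O'.toSubring with
      mem_or_inv_mem' := fun x => by
        rcases ValuationRing.isInteger_or_isInteger O'.toSubring x with ⟨y, hy⟩ | ⟨y, hy⟩
        · exact Or.inl (hy ▸ y.2)
        · exact Or.inr (hy ▸ y.2) }
  refine ⟨O, LocalSubring.ofPrime B m, ?_, ?_, ?_, hdim, hAO, ?_⟩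
  · intro x hx
    obtain ⟨b, d, hd, rfl⟩ := mem_ofPrime_iff.1 hx
    exact mem_ofPrime_iff.2 ⟨b, d, fun h => hd (hPm h), rfl⟩
  · intro z hz
    have hzB : z ∈ B := Algebra.subset_adjoin (hZG (Finset.mem_insert_of_mem hz))
    refine ⟨LocalSubring.le_ofPrime B m hzB, ?_⟩
    refine (IsLocalization.AtPrime.to_map_mem_maximal_iff (LocalSubring.ofPrime B m).toSubring m
      ⟨z, hzB⟩).2 (hmle ?_)
    exact (W.valuation_lt_one_iff _).2 (hZ z hz)
  · intro e he he0
    exact hunit e (by simp [N, he]) he0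
  · exact hloc A nA dA hnA hdA hdA0 hxA fun g hg => by
      simp only [N, Finset.mem_union]
      exact Or.inl (Or.inl (Or.inr (Finset.mem_image_of_mem _ hg)))

end FieldModel

/-! ### Affine charts of the variety and their codimension-one points. -/

namespace DrinfeldAdele

open IsLocalRing

/-- An affine chart of a model: a finitely generated `F`-algebra with fraction field `K` such that
each of its one-dimensional localizations that is a valuation ring is a place of the model. -/
theorem SmoothProjectiveModel.exists_chart {F K : Type u} [Field F] [Field K] [Algebra F K]
    (V : SmoothProjectiveModel F K) :
    ∃ A : Subalgebra F K, A.FG ∧ (∀ x : K, ∃ a ∈ A, ∃ b ∈ A, b ≠ 0 ∧ x = a / b) ∧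
      ∀ O : ValuationSubring K, (∀ a ∈ A, a ∈ O) →
        (∀ x ∈ O, ∃ a ∈ A, ∃ d ∈ A, d ≠ 0 ∧ d⁻¹ ∈ O ∧ x = a / d) → ringKrullDim O = 1 →
        O ∈ V.places := by
  have hsmooth := V.smooth
  obtain ⟨U, hU, hxU, -⟩ := exists_isAffineOpen_mem_and_subset (X := V.scheme)
    (x := genericPoint V.scheme) (U := ⊤) trivial
  have hne : Nonempty U := ⟨⟨_, hxU⟩⟩
  have hfrac := functionField_isFractionRing_of_isAffineOpen V.scheme U hU
  let φ : Γ(V.scheme, U) →+* K :=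
    V.functionFieldEquiv.toRingHom.comp (algebraMap Γ(V.scheme, U) V.scheme.functionField)
  have hφ : Function.Injective φ :=
    V.functionFieldEquiv.injective.comp (IsFractionRing.injective _ _)
  let α := (Scheme.ΓSpecIso (CommRingCat.of F)).inv ≫ V.toSpec.appLE ⊤ U le_top
  have hα : α.hom.FiniteType := by
    have h1 := V.toSpec.finiteType_appLE (isAffineOpen_top _) hU le_top
    have h2 : (Scheme.ΓSpecIso (CommRingCat.of F)).inv.hom.FiniteType :=
      RingHom.FiniteType.of_surjective _
        (Scheme.ΓSpecIso (CommRingCat.of F)).symm.commRingCatIsoToRingEquiv.surjective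
    exact h1.comp h2
  let _ : Algebra F Γ(V.scheme, U) := α.hom.toAlgebra
  have hft : Algebra.FiniteType F Γ(V.scheme, U) := hα
  let Φ : Γ(V.scheme, U) →ₐ[F] K :=
    { φ with
      commutes' := fun c => by
        rw [← V.functionFieldEquiv_base c]
        refine congrArg V.functionFieldEquiv ?_
        have h := V.scheme.presheaf.germ_res_apply (homOfLE (le_top : U ≤ ⊤))
          (genericPoint V.scheme) hxU
          (V.toSpec.appTop ((Scheme.ΓSpecIso (CommRingCat.of F)).inv c))
        exact h }
  refine ⟨Φ.range, ?_, ?_, ?_⟩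
  · rw [← Algebra.map_top]
    exact hft.out.map _
  · intro x
    obtain ⟨a, b, hb, h⟩ := IsFractionRing.div_surjective (A := Γ(V.scheme, U))
      (V.functionFieldEquiv.symm x)
    refine ⟨φ a, ⟨a, rfl⟩, φ b, ⟨b, rfl⟩,
      (map_ne_zero_iff φ hφ).2 (nonZeroDivisors.ne_zero hb), ?_⟩
    have := congrArg V.functionFieldEquiv h
    rw [map_div₀, RingEquiv.apply_symm_apply] at this
    exact this.symm
  · intro O hAO hO hdim
    let ψ : Γ(V.scheme, U) →+* O := φ.codRestrict O.toSubring fun a => hAO _ ⟨a, rfl⟩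
    -- The point sought is the centre of `O` on the chart; `O` turns out to be its stalk, so the
    -- dimension of `O` is the codimension of the point.
    let y : PrimeSpectrum Γ(V.scheme, U) := ⟨(maximalIdeal O).comap ψ, Ideal.comap_isPrime _ _⟩
    have hy : ∀ a, a ∈ y.asIdeal ↔ φ a = 0 ∨ (φ a)⁻¹ ∉ O := by
      intro a
      change ψ a ∈ maximalIdeal O ↔ _
      rw [mem_maximalIdeal, mem_nonunits_iff, ← not_iff_not, not_not, not_or, not_not]
      constructor
      · rintro ⟨u, hu⟩
        have h1 : φ a * ((u⁻¹ : Oˣ) : O) = 1 := by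
          have h2 := congrArg (Subtype.val : O → K) u.mul_inv
          rw [hu] at h2
          exact h2
        refine ⟨left_ne_zero_of_mul_eq_one h1, ?_⟩
        rw [inv_eq_of_mul_eq_one_right h1]
        exact Subtype.property _
      · rintro ⟨h0, h1⟩
        exact IsUnit.of_mul_eq_one ⟨_, h1⟩ (Subtype.ext (mul_inv_cancel₀ h0))
    have hyU : hU.fromSpec y ∈ U := (hU.isoSpec.inv y).2
    let x := hU.fromSpec y
    let _ : Algebra Γ(V.scheme, U) (V.scheme.presheaf.stalk x) :=
      TopCat.Presheaf.algebra_section_stalk V.scheme.presheaf ⟨_, hyU⟩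
    have hloc : IsLocalization.AtPrime (V.scheme.presheaf.stalk x) y.asIdeal :=
      hU.isLocalization_stalk' y hyU
    have htower : IsScalarTower Γ(V.scheme, U) (V.scheme.presheaf.stalk x)
      V.scheme.functionField := functionField_isScalarTower V.scheme U ⟨_, hyU⟩
    let ρ : V.scheme.presheaf.stalk x →+* K :=
      V.functionFieldEquiv.toRingHom.comp (algebraMap _ V.scheme.functionField)
    have hρinj : Function.Injective ρ :=
      V.functionFieldEquiv.injective.comp (IsFractionRing.injective _ _)
    have hρ : ∀ a, ρ (algebraMap Γ(V.scheme, U) _ a) = φ a := fun a =>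
      congrArg V.functionFieldEquiv (IsScalarTower.algebraMap_apply _ _ _ a).symm
    have hρu : ∀ (s : V.scheme.presheaf.stalk x) (a d), d ∉ y.asIdeal →
        s * algebraMap Γ(V.scheme, U) _ d = algebraMap Γ(V.scheme, U) _ a → ρ s = φ a / φ d := by
      intro s a d hd h
      rw [hy, not_or] at hd
      rw [eq_div_iff hd.1, ← hρ, ← hρ, ← map_mul, h]
    have hmem : ∀ z, z ∈ O ↔ ∃ s, ρ s = z := by
      intro z
      constructor
      · intro hz
        obtain ⟨_, ⟨a, rfl⟩, _, ⟨d, rfl⟩, hd0, hdO, rfl⟩ := hO z hz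
        have hd : d ∉ y.asIdeal := by
          rw [hy, not_or, not_not]
          exact ⟨hd0, hdO⟩
        exact ⟨IsLocalization.mk' _ a (⟨d, hd⟩ : y.asIdeal.primeCompl),
          hρu _ a d hd (IsLocalization.mk'_spec _ a (⟨d, hd⟩ : y.asIdeal.primeCompl))⟩
      · rintro ⟨s, rfl⟩
        obtain ⟨⟨a, d⟩, h⟩ := IsLocalization.surj y.asIdeal.primeCompl s
        rw [hρu s a d d.2 h, div_eq_mul_inv]
        have hd : (d : Γ(V.scheme, U)) ∉ y.asIdeal := d.2
        rw [hy, not_or, not_not] at hd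
        exact mul_mem (hAO _ ⟨a, rfl⟩) hd.2
    refine ⟨x, ?_, ?_⟩
    · let e : V.scheme.presheaf.stalk x ≃+* O := RingEquiv.ofBijective
        (ρ.codRestrict O.toSubring fun s => (hmem _).2 ⟨s, rfl⟩)
        ⟨fun s t h => hρinj (congrArg Subtype.val h), fun z => by
          obtain ⟨s, hs⟩ := (hmem z).1 z.2
          exact ⟨s, Subtype.ext hs⟩⟩
      have h := ringKrullDim_stalk_eq_coheight x
      rw [ringKrullDim_eq_of_ringEquiv e, hdim] at h
      exact_mod_cast h.symm
    · ext z
      exact hmem z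

end DrinfeldAdele

/-! ### Places of the variety refining a given valuation ring. -/

namespace DrinfeldAdele

open IsLocalRing

theorem mem_adjoin_algebraMap_X {k K : Type*} [Field k] [Field K] [Algebra k K]
    (f : RatFunc k →ₐ[k] K) (r : RatFunc k) :
    f r ∈ IntermediateField.adjoin k {f RatFunc.X} := by
  have h : ∀ q : k[X], f (algebraMap k[X] (RatFunc k) q) = aeval (f RatFunc.X) q := by
    intro q
    rw [Polynomial.aeval_algHom_apply]
    congr 1
    rw [← RatFunc.algebraMap_X, Polynomial.aeval_algebraMap_apply, Polynomial.aeval_X_left_apply]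
  rw [← RatFunc.num_div_denom r, map_div₀, h, h]
  exact (IntermediateField.mem_adjoin_simple_iff k _).2 ⟨_, _, rfl⟩

theorem transcendental_algebraMap_X {k K : Type*} [Field k] [Field K] [Algebra k K]
    (f : RatFunc k →ₐ[k] K) : Transcendental k (f RatFunc.X) := by
  rw [transcendental_iff]
  intro q hq
  rw [Polynomial.aeval_algHom_apply] at hq
  have := (map_eq_zero_iff f f.toRingHom.injective).1 hq
  rwa [← RatFunc.algebraMap_X, Polynomial.aeval_algebraMap_apply, Polynomial.aeval_X_left_apply,
    map_eq_zero_iff _ (IsFractionRing.injective k[X] (RatFunc k))] at this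

variable {p : ℕ} [Fact p.Prime] {F K : Type u} [Field F] [Field K]
  [Algebra (RatFunc (ZMod p)) F] [FiniteDimensional (RatFunc (ZMod p)) F] [Algebra F K]

theorem SmoothProjectiveModel.essFiniteType [Algebra (ZMod p) K] (V : SmoothProjectiveModel F K) :
    Algebra.EssFiniteType (ZMod p) K := by
  let _ : Algebra (ZMod p) F :=
    ((algebraMap (RatFunc (ZMod p)) F).comp (algebraMap (ZMod p) _)).toAlgebra
  have : IsScalarTower (ZMod p) (RatFunc (ZMod p)) F := .of_algebraMap_eq fun _ => rfl
  have : IsScalarTower (ZMod p) F K := .of_algebraMap_eq' (Subsingleton.elim _ _)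
  obtain ⟨A, hA, hfrac, -⟩ := V.exists_chart
  have hAft : Algebra.FiniteType F A := (Subalgebra.fg_iff_finiteType _).1 hA
  have : IsFractionRing A K := IsFractionRing.of_field _ _ fun x => by
    obtain ⟨a, ha, b, hb, -, rfl⟩ := hfrac x
    exact ⟨⟨a, ha⟩, ⟨b, hb⟩, rfl⟩
  have h1 : Algebra.EssFiniteType A K := .of_isLocalization K (nonZeroDivisors A)
  have h2 : Algebra.EssFiniteType F K := .comp F A K
  have h3 : Algebra.EssFiniteType (ZMod p)[X] (RatFunc (ZMod p)) :=
    .of_isLocalization _ (nonZeroDivisors (ZMod p)[X])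
  have h4 : Algebra.EssFiniteType (ZMod p) (RatFunc (ZMod p)) := .comp _ (ZMod p)[X] _
  have h5 : Algebra.EssFiniteType (ZMod p) F := .comp _ (RatFunc (ZMod p)) _
  exact .comp _ F _

/-- The divisorial places of a model refine arbitrary valuation rings of its function field. -/
theorem SmoothProjectiveModel.exists_place [CharP K p] (hK : 1 ≤ Algebra.trdeg F K)
    (V : SmoothProjectiveModel F K) (W : ValuationSubring K) (Z : Finset K)
    (hZ : ∀ z ∈ Z, W.valuation z < 1) (E : Finset K) :
    ∃ O ∈ V.places, ∃ R : LocalSubring K, R.toSubring ≤ O.toSubring ∧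
      (∀ z ∈ Z, ∃ h : z ∈ R.toSubring, (⟨z, h⟩ : R.toSubring) ∈ maximalIdeal R.toSubring) ∧
      ∀ e ∈ E, e ≠ 0 → e ∈ O ∧ e⁻¹ ∈ O := by
  classical
  let _ : Algebra (ZMod p) K := ZMod.algebra K p
  let _ : Algebra (ZMod p) F :=
    ((algebraMap (RatFunc (ZMod p)) F).comp (algebraMap (ZMod p) _)).toAlgebra
  have : IsScalarTower (ZMod p) (RatFunc (ZMod p)) F := .of_algebraMap_eq fun _ => rfl
  have htower : IsScalarTower (ZMod p) F K := .of_algebraMap_eq' (Subsingleton.elim _ _)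
  have hess : Algebra.EssFiniteType (ZMod p) K := V.essFiniteType
  let fF : RatFunc (ZMod p) →ₐ[ZMod p] F := IsScalarTower.toAlgHom _ _ _
  let fK : RatFunc (ZMod p) →ₐ[ZMod p] K := (IsScalarTower.toAlgHom (ZMod p) F K).comp fF
  have htr : 2 ≤ Algebra.trdeg (ZMod p) K := by
    have hF : 1 ≤ Algebra.trdeg (ZMod p) F := by
      rw [Cardinal.one_le_iff_ne_zero, ne_eq, trdeg_eq_zero_iff]
      exact fun h => transcendental_algebraMap_X fF (h.isAlgebraic _)
    rw [← trdeg_add_eq (ZMod p) F (A := K), ← one_add_one_eq_two]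
    exact add_le_add hF hK
  obtain ⟨A, ⟨H, hH⟩, hfrac, hplace⟩ := V.exists_chart
  obtain ⟨T, hT⟩ := (Module.finite_def (R := RatFunc (ZMod p)) (M := F)).1 inferInstance
  obtain ⟨O, R, hRO, hRZ, hE, hdim, hAO, hloc⟩ := FieldModel.exists_valuationSubring htr
    (transcendental_algebraMap_X fK) (A.restrictScalars (ZMod p)) hfrac
    -- A ring containing `𝔽_p(t)` and the images of the spanning set `T` contains `F`, and with `H`
    -- it contains the chart.
    (H ∪ T.image (algebraMap F K)) (by
      intro O hτ hO a ha
      have hF : ∀ c : F, algebraMap F K c ∈ O := by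
        intro c
        have hc : c ∈ Submodule.span (RatFunc (ZMod p)) (T : Set F) := hT ▸ Submodule.mem_top
        induction hc using Submodule.span_induction with
        | mem x hx => exact hO _ (Finset.mem_union_right _ (Finset.mem_image_of_mem _ hx))
        | zero => rw [map_zero]; exact zero_mem _
        | add x y _ _ hx hy => rw [map_add]; exact add_mem hx hy
        | smul r x _ hx =>
          rw [Algebra.smul_def, map_mul]
          exact mul_mem (hτ _ (mem_adjoin_algebraMap_X fK r)) hx
      have ha' : a ∈ Algebra.adjoin F (H : Set K) := hH ▸ ha
      exact Algebra.adjoin_induction (p := fun x _ => x ∈ O)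
        (fun x hx => hO x (Finset.mem_union_left _ hx)) hF
        (fun _ _ _ _ => add_mem) (fun _ _ _ _ => mul_mem) ha')
    W (fun c => by
      obtain ⟨n, rfl⟩ := ZMod.intCast_surjective c
      rw [map_intCast]
      exact intCast_mem _ _) Z hZ E
  exact ⟨O, hplace O hAO hloc hdim, R, hRO, hRZ, hE⟩

end DrinfeldAdele

/-! ### Orbits escaping to infinity, measured in a local ring. -/

namespace DrinfeldAdele

open IsLocalRing

section LocalSubring

variable {K : Type u} [Field K] (R : LocalSubring K)

/-- The maximal ideal of a local subring of a field, as a subset of the field. -/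
def maximalSubgroup : AddSubgroup K :=
  (maximalIdeal R.toSubring).toAddSubgroup.map R.toSubring.subtype.toAddMonoidHom

variable {R}

theorem mem_maximalSubgroup {x : K} :
    x ∈ maximalSubgroup R ↔ ∃ h : x ∈ R.toSubring,
      (⟨x, h⟩ : R.toSubring) ∈ maximalIdeal R.toSubring := by
  constructor
  · rintro ⟨y, hy, rfl⟩
    exact ⟨y.2, hy⟩
  · rintro ⟨h, hx⟩
    exact ⟨⟨x, h⟩, hx, rfl⟩

theorem mem_of_mem_maximalSubgroup {x : K} (hx : x ∈ maximalSubgroup R) : x ∈ R.toSubring :=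
  (mem_maximalSubgroup.1 hx).1

theorem mul_mem_maximalSubgroup {r x : K} (hr : r ∈ R.toSubring) (hx : x ∈ maximalSubgroup R) :
    r * x ∈ maximalSubgroup R := by
  obtain ⟨h, hx⟩ := mem_maximalSubgroup.1 hx
  exact mem_maximalSubgroup.2 ⟨mul_mem hr h, Ideal.mul_mem_left _ ⟨r, hr⟩ hx⟩

/-- Translation by the maximal ideal preserves units. This replaces the ultrametric "dominant term"
argument, since `R` is only a local ring and carries no valuation. -/
theorem inv_mem_of_sub_mem_maximalSubgroup {r x : K} (hr0 : r ≠ 0) (hr : r ∈ R.toSubring)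
    (hr' : r⁻¹ ∈ R.toSubring) (hx : x - r ∈ maximalSubgroup R) : x ≠ 0 ∧ x⁻¹ ∈ R.toSubring := by
  obtain ⟨h, hm⟩ := mem_maximalSubgroup.1 hx
  have hxR : x ∈ R.toSubring := by simpa using add_mem h hr
  have hu : IsUnit (⟨x, hxR⟩ : R.toSubring) := by
    by_contra hn
    have hxm : (⟨x, hxR⟩ : R.toSubring) ∈ maximalIdeal R.toSubring := hn
    have hrm : (⟨r, hr⟩ : R.toSubring) ∈ maximalIdeal R.toSubring := by
      have := sub_mem hxm hm
      convert this using 1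
      exact Subtype.ext (sub_sub_cancel _ _).symm
    exact hrm (IsUnit.of_mul_eq_one ⟨_, hr'⟩ (Subtype.ext (mul_inv_cancel₀ hr0)))
  obtain ⟨z, hz⟩ := hu.exists_right_inv
  have hz' : x * z = 1 := congrArg Subtype.val hz
  exact ⟨left_ne_zero_of_mul_eq_one hz', by rw [inv_eq_of_mul_eq_one_right hz']; exact z.2⟩

/-- If `y` is large compared with the coefficients of an additive polynomial `f`, then `f(y)` is
large compared with `y`. -/
theorem div_sum_mem_maximalSubgroup {p d D : ℕ} (hp : 2 ≤ p) (hd : 1 ≤ d) (hdD : d ≤ D) {c : ℕ → K}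
    (hc : c D ≠ 0) {y : K} (hy : y ≠ 0) (h1 : y⁻¹ ∈ maximalSubgroup R)
    (hD : (c D)⁻¹ / y ∈ maximalSubgroup R)
    (hi : ∀ i ∈ Finset.Icc d D, i ≠ D → c i / c D / y ∈ maximalSubgroup R) :
    ∑ i ∈ Finset.Icc d D, c i * y ^ p ^ i ≠ 0 ∧
      y / ∑ i ∈ Finset.Icc d D, c i * y ^ p ^ i ∈ maximalSubgroup R := by
  have hpow : ∀ n : ℕ, (y⁻¹) ^ n ∈ R.toSubring := fun n =>
    pow_mem (mem_of_mem_maximalSubgroup h1) n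
  set w := ∑ i ∈ Finset.Icc d D, c i / c D * (y ^ p ^ i / y ^ p ^ D) with hw
  have hsum : ∑ i ∈ Finset.Icc d D, c i * y ^ p ^ i = c D * y ^ p ^ D * w := by
    rw [hw, Finset.mul_sum]
    refine Finset.sum_congr rfl fun i _ => ?_
    field_simp
  -- After division by the top term `c D * y ^ p ^ D`, every other term lies in the maximal ideal.
  have hwm : w - 1 ∈ maximalSubgroup R := by
    rw [hw, ← Finset.add_sum_erase _ _ (Finset.mem_Icc.2 ⟨hdD, le_rfl⟩), div_self hc,
      div_self (pow_ne_zero _ hy), mul_one, add_sub_cancel_left]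
    refine sum_mem fun i hi' => ?_
    obtain ⟨hne, hmem⟩ := Finset.mem_erase.1 hi'
    have hlt : p ^ i < p ^ D := Nat.pow_lt_pow_right hp
      (lt_of_le_of_ne (Finset.mem_Icc.1 hmem).2 hne)
    have : c i / c D * (y ^ p ^ i / y ^ p ^ D) = y⁻¹ ^ (p ^ D - p ^ i - 1) * (c i / c D / y) := by
      obtain ⟨e, he⟩ := Nat.exists_eq_add_of_lt hlt
      rw [he, show p ^ i + e + 1 - p ^ i - 1 = e by omega, pow_succ, pow_add,
        inv_pow]
      field_simp
    rw [this]
    exact mul_mem_maximalSubgroup (hpow _) (hi i hmem hne)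
  obtain ⟨hw0, hwR⟩ := inv_mem_of_sub_mem_maximalSubgroup one_ne_zero (one_mem _)
    (by simp [one_mem]) hwm
  rw [hsum]
  refine ⟨mul_ne_zero (mul_ne_zero hc (pow_ne_zero _ hy)) hw0, ?_⟩
  -- One power of `y` is cancelled by the numerator and one is paired with `(c D)⁻¹`; here `D ≥ 1`
  -- is essential.
  have h2 : 2 ≤ p ^ D := hp.trans (Nat.le_self_pow (by omega) p)
  have : y / (c D * y ^ p ^ D * w) = w⁻¹ * (y⁻¹ ^ (p ^ D - 2) * ((c D)⁻¹ / y)) := by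
    obtain ⟨e, he⟩ := Nat.exists_eq_add_of_le h2
    rw [he, Nat.add_sub_cancel_left, pow_add, inv_pow]
    field_simp
  rw [this]
  exact mul_mem_maximalSubgroup hwR (mul_mem_maximalSubgroup (hpow _) hD)

end LocalSubring

variable {p : ℕ} {K : Type u} [Field K] {Φ : SpecialDrinfeldModule p K}

theorem C_smul (c : ZMod p) [NeZero p] (x : Pt Φ K) : (C c : (ZMod p)[X]) • x = c.val • x := by
  have : (C c : (ZMod p)[X]) = ((c.val : ℕ) : (ZMod p)[X]) := by
    rw [← Polynomial.C_eq_natCast, ZMod.natCast_val, ZMod.cast_id]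
  rw [this, Nat.cast_smul_eq_nsmul]

theorem smul_eq_sum [NeZero p] (b : (ZMod p)[X]) (x : Pt Φ K) :
    b • x = ∑ i ∈ Finset.range (b.natDegree + 1),
      (b.coeff i).val • ((X ^ i : (ZMod p)[X]) • x) := by
  conv_lhs => rw [b.as_sum_range_C_mul_X_pow, Finset.sum_smul]
  refine Finset.sum_congr rfl fun i _ => ?_
  rw [mul_smul, C_smul]

/-- A subgroup stable under `Φ_t` is stable under the action of `𝔽_p[t]`. -/
theorem smul_mem_of_X_smul_mem [NeZero p] {S : AddSubgroup (Pt Φ K)}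
    (hS : ∀ x ∈ S, (X : (ZMod p)[X]) • x ∈ S) (b : (ZMod p)[X]) {x : Pt Φ K} (hx : x ∈ S) :
    b • x ∈ S := by
  rw [smul_eq_sum]
  refine sum_mem fun i _ => nsmul_mem (?_ : (X ^ i : (ZMod p)[X]) • x ∈ S) _
  clear * - hS hx
  induction i with
  | zero => simpa using hx
  | succ i ih => rw [pow_succ', mul_smul]; exact hS _ ih

variable (Φ) in
/-- The points of `𝔾_a(K)` are the elements of `K`. -/
def toField : Pt Φ K ≃+ K := AddEquiv.refl K

theorem div_iterate_mem {R : LocalSubring K} {z : ℕ → K} (h0 : ∀ n, z n ≠ 0)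
    (hdiv : ∀ n, z n / z (n + 1) ∈ maximalSubgroup R) {i N : ℕ} (h : i < N) :
    z i / z N ∈ maximalSubgroup R := by
  induction N with
  | zero => omega
  | succ N ih =>
    rcases Nat.lt_succ_iff_lt_or_eq.1 h with h | rfl
    · rw [← div_mul_div_cancel₀ (h0 N)]
      exact mul_mem_maximalSubgroup (mem_of_mem_maximalSubgroup (ih h)) (hdiv N)
    · exact hdiv i

/-- If the orbit of `y` under `Φ_t` escapes to infinity then so do all `Φ_b(y)`. -/
theorem inv_smul_mem_of_div_mem [Fact p.Prime] [CharP K p] {R : LocalSubring K} {y : Pt Φ K}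
    (h0 : ∀ n : ℕ, toField Φ ((X ^ n : (ZMod p)[X]) • y) ≠ 0)
    (h1 : ∀ n : ℕ, (toField Φ ((X ^ n : (ZMod p)[X]) • y))⁻¹ ∈ R.toSubring)
    (hdiv : ∀ n : ℕ, toField Φ ((X ^ n : (ZMod p)[X]) • y) /
      toField Φ ((X ^ (n + 1) : (ZMod p)[X]) • y) ∈ maximalSubgroup R)
    {b : (ZMod p)[X]} (hb : b ≠ 0) :
    toField Φ (b • y) ≠ 0 ∧ (toField Φ (b • y))⁻¹ ∈ R.toSubring := by
  set z : ℕ → K := fun n => toField Φ ((X ^ n : (ZMod p)[X]) • y) with hz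
  set N := b.natDegree with hN
  have hsum : toField Φ (b • y) = ∑ i ∈ Finset.range (N + 1), ((b.coeff i).val : K) * z i := by
    rw [smul_eq_sum, map_sum]
    refine Finset.sum_congr rfl fun i _ => ?_
    rw [map_nsmul, nsmul_eq_mul]
  have hunit : ((b.coeff N).val : K) * ((b.coeff N)⁻¹.val : K) = 1 := by
    have h : (b.coeff N) * (b.coeff N)⁻¹ = 1 :=
      mul_inv_cancel₀ (by rwa [hN, coeff_natDegree, ne_eq, leadingCoeff_eq_zero])
    have h2 := congrArg (ZMod.castHom (dvd_refl p) K) h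
    rw [map_mul, map_one] at h2
    simpa only [ZMod.castHom_apply, ZMod.natCast_val] using h2
  -- The term of highest degree in `t` dominates, and its coefficient is a unit coming from `𝔽_p`.
  have hm : toField Φ (b • y) / z N - ((b.coeff N).val : K) ∈ maximalSubgroup R := by
    rw [hsum, Finset.sum_range_succ, add_div, mul_div_cancel_right₀ _ (h0 N), add_sub_cancel_right,
      Finset.sum_div]
    refine sum_mem fun i hi => ?_
    rw [mul_div_assoc]
    exact mul_mem_maximalSubgroup (natCast_mem _ _)
      (div_iterate_mem h0 hdiv (Finset.mem_range.1 hi))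
  obtain ⟨hne, hinv⟩ := inv_mem_of_sub_mem_maximalSubgroup (left_ne_zero_of_mul_eq_one hunit)
    (natCast_mem _ _) (by
      rw [inv_eq_of_mul_eq_one_right hunit]
      exact natCast_mem _ _) hm
  refine ⟨(div_ne_zero_iff.1 hne).1, ?_⟩
  have : (toField Φ (b • y))⁻¹ = (toField Φ (b • y) / z N)⁻¹ * (z N)⁻¹ := by
    rw [inv_div, div_mul_eq_mul_div, mul_inv_cancel₀ (h0 N), one_div]
  rw [this]
  exact mul_mem hinv (h1 N)

end DrinfeldAdele

/-! ### Reduction at a place and non-torsion points. -/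

namespace DrinfeldAdele

open IsLocalRing

section Action

variable {p : ℕ} {K : Type u} [Field K] {Φ : SpecialDrinfeldModule p K}

theorem toField_smul (b : (ZMod p)[X]) (x : Pt Φ K) :
    toField Φ (b • x) = aeval (toField Φ x) (Φ.hom b).poly := rfl

variable (Φ) in
/-- The points reducing to zero at a place. -/
def reductionKernel (O : ValuationSubring K) : AddSubgroup (Pt Φ K) where
  carrier := {x | O.valuation (toField Φ x) < 1}
  add_mem' {x y} hx hy := by
    rw [Set.mem_ofPred_eq, map_add]
    exact O.valuation.map_add_lt hx hy
  zero_mem' := by simp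
  neg_mem' {x} hx := by
    rw [Set.mem_ofPred_eq, map_neg, Valuation.map_neg]
    exact hx

theorem mem_reductionKernel {O : ValuationSubring K} {x : Pt Φ K} :
    x ∈ reductionKernel Φ O ↔ O.valuation (toField Φ x) < 1 := Iff.rfl

variable [Fact p.Prime]

theorem coeff_zero_eq_zero (Φ : SpecialDrinfeldModule p K) : (Φ.hom X).poly.coeff 0 = 0 := by
  obtain ⟨d, D, c, -, -, -, -, h⟩ := Φ.special
  rw [h, finsetSum_coeff]
  refine Finset.sum_eq_zero fun i _ => ?_
  rw [coeff_C_mul_X_pow, if_neg (pow_pos (Fact.out : p.Prime).pos i).ne]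

theorem smul_mem_reductionKernel {O : ValuationSubring K} (hO : ∀ n, (Φ.hom X).poly.coeff n ∈ O)
    (b : (ZMod p)[X]) {x : Pt Φ K} (hx : x ∈ reductionKernel Φ O) :
    b • x ∈ reductionKernel Φ O := by
  refine smul_mem_of_X_smul_mem (fun y hy => ?_) b hx
  rw [mem_reductionKernel, toField_smul, Polynomial.aeval_eq_sum_range]
  refine Valuation.map_sum_lt _ one_ne_zero fun n _ => ?_
  rcases n.eq_zero_or_pos with rfl | hn
  · simp [coeff_zero_eq_zero]
  · rw [smul_eq_mul, map_mul, map_pow]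
    exact mul_lt_one_of_nonneg_of_lt_one_right ((O.valuation_le_one_iff _).2 (hO n)) zero_le
      (pow_lt_one₀ zero_le hy hn.ne')

theorem smul_mem_of_coeff_mem {O : ValuationSubring K} (hO : ∀ n, (Φ.hom X).poly.coeff n ∈ O)
    (b : (ZMod p)[X]) {x : Pt Φ K} (hx : toField Φ x ∈ O) : toField Φ (b • x) ∈ O := by
  refine smul_mem_of_X_smul_mem (S := O.toSubring.toAddSubgroup.comap (toField Φ).toAddMonoidHom)
    (fun y hy => ?_) b hx
  change toField Φ (X • y) ∈ O
  rw [toField_smul, Polynomial.aeval_eq_sum_range]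
  exact sum_mem fun n _ => mul_mem (hO n) (pow_mem (show toField Φ y ∈ O from hy) n)

theorem toField_X_smul {d D : ℕ} {c : ℕ → K}
    (h : (Φ.hom X).poly = ∑ i ∈ Finset.Icc d D, C (c i) * X ^ p ^ i) (y : Pt Φ K) :
    toField Φ ((X : (ZMod p)[X]) • y) = ∑ i ∈ Finset.Icc d D, c i * toField Φ y ^ p ^ i := by
  rw [toField_smul, h]
  simp

end Action

variable {p : ℕ} [Fact p.Prime] {F K : Type u} [Field F] [Field K]
  [Algebra (RatFunc (ZMod p)) F] [FiniteDimensional (RatFunc (ZMod p)) F] [Algebra F K]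
  {Φ : SpecialDrinfeldModule p K}

/-- The orbit of a non-torsion point is unbounded at some valuation. -/
theorem exists_valuation_lt_iterate [CharP K p] (V : SmoothProjectiveModel F K) {x : Pt Φ K}
    (hx : ∀ b : (ZMod p)[X], b ≠ 0 → b • x ≠ 0) (U : Finset K) :
    ∃ (n : ℕ) (W : ValuationSubring K), ∀ u ∈ U,
      W.valuation u < W.valuation (toField Φ ((X ^ n : (ZMod p)[X]) • x)) := by
  let _ : Algebra (ZMod p) K := ZMod.algebra K p
  have hess := V.essFiniteType (p := p)
  have hfin := ValuationBound.finite_setOf_forall_valuation_le (ZMod p) U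
  by_contra! h
  have hinj : Function.Injective fun n : ℕ => toField Φ ((X ^ n : (ZMod p)[X]) • x) := by
    intro n m hnm
    by_contra hne
    refine hx (X ^ n - X ^ m) (sub_ne_zero.2 fun h => hne ?_) ?_
    -- A repetition in the orbit would make `x` torsion, killed by the nonzero polynomial `X ^ n - X
    -- ^ m`.
    · simpa using congrArg natDegree h
    · rw [sub_smul, sub_eq_zero]
      exact (toField Φ).injective hnm
  exact Set.infinite_range_of_injective hinj (hfin.subset (by
    rintro _ ⟨n, rfl⟩ W
    exact h n W))

/-- A non-torsion point has non-torsion reduction at some place. -/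
theorem exists_place_forall_smul_notMem_reductionKernel [CharP K p] (hK : 1 ≤ Algebra.trdeg F K)
    (V : SmoothProjectiveModel F K) {x : Pt Φ K} (hx : ∀ b : (ZMod p)[X], b ≠ 0 → b • x ≠ 0)
    {E : Finset K} (hE : ∀ n, (Φ.hom X).poly.coeff n ∈ E) :
    ∃ O ∈ V.places, (∀ e ∈ E, e ≠ 0 → e ∈ O ∧ e⁻¹ ∈ O) ∧
      ∀ b : (ZMod p)[X], b ≠ 0 → b • x ∉ reductionKernel Φ O := by
  classical
  obtain ⟨d, D, c, hd, hdD, -, hcD, hΦ⟩ := Φ.special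
  -- These are exactly the quantities that `y` must dominate in `div_sum_mem_maximalSubgroup`.
  let U : Finset K := insert 1 (insert (c D)⁻¹ ((Finset.Icc d D).image fun i => c i / c D))
  obtain ⟨N, W, hW⟩ := exists_valuation_lt_iterate V hx U
  set y : Pt Φ K := (X ^ N : (ZMod p)[X]) • x with hy
  obtain ⟨O, hO, R, hRO, hZ, hEO⟩ := V.exists_place (p := p) hK W
    (U.image fun u => u / toField Φ y) (by
      intro z hz
      obtain ⟨u, hu, rfl⟩ := Finset.mem_image.1 hz
      rw [map_div₀]
      exact (div_lt_one₀ (zero_le.trans_lt (hW u hu))).2 (hW u hu)) E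
  refine ⟨O, hO, hEO, fun b hb hmem => ?_⟩
  have hcoeff : ∀ n, (Φ.hom X).poly.coeff n ∈ O := fun n => by
    rcases eq_or_ne ((Φ.hom X).poly.coeff n) 0 with h | h
    · rw [h]; exact zero_mem _
    · exact (hEO _ (hE n) h).1
  set z : ℕ → K := fun n => toField Φ ((X ^ n : (ZMod p)[X]) • y) with hz
  have hz0 : ∀ n, z n ≠ 0 := fun n h => by
    rw [hz] at h
    simp only [hy, ← mul_smul] at h
    exact hx _ (mul_ne_zero (pow_ne_zero _ X_ne_zero) (pow_ne_zero _ X_ne_zero))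
      ((map_eq_zero_iff _ (toField Φ).injective).1 h)
  have hzs : ∀ n, z (n + 1) = ∑ i ∈ Finset.Icc d D, c i * z n ^ p ^ i := fun n => by
    rw [hz]
    simp only
    rw [pow_succ', mul_smul, toField_X_smul hΦ]
  have hstep : ∀ n, (∀ u ∈ U, u / z n ∈ maximalSubgroup R) →
      z n / z (n + 1) ∈ maximalSubgroup R := by
    intro n hn
    rw [hzs]
    refine (div_sum_mem_maximalSubgroup (Fact.out : p.Prime).two_le hd hdD hcD (hz0 n) ?_ ?_ ?_).2
    · rw [← one_div]
      exact hn 1 (Finset.mem_insert_self _ _)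
    · exact hn _ (Finset.mem_insert_of_mem (Finset.mem_insert_self _ _))
    · intro i hi _
      exact hn _ (Finset.mem_insert_of_mem (Finset.mem_insert_of_mem
        (Finset.mem_image_of_mem _ hi)))
  have hU : ∀ n, ∀ u ∈ U, u / z n ∈ maximalSubgroup R := by
    intro n
    induction n with
    | zero =>
      intro u hu
      have : z 0 = toField Φ y := by simp [hz]
      rw [this]
      exact mem_maximalSubgroup.2 (hZ _ (Finset.mem_image_of_mem _ hu))
    | succ n ih =>
      intro u hu
      rw [← div_mul_div_cancel₀ (hz0 n)]
      exact mul_mem_maximalSubgroup (mem_of_mem_maximalSubgroup (ih u hu)) (hstep n ih)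
  obtain ⟨hne, hinv⟩ := inv_smul_mem_of_div_mem (R := R) (y := y) hz0
    (fun n => by
      have := mem_of_mem_maximalSubgroup (hU n 1 (Finset.mem_insert_self _ _))
      rwa [one_div] at this)
    (fun n => hstep n (hU n)) hb
  -- If `b • x` reduced to zero, so would its multiple `X ^ N • b • x = b • y`, yet the inverse of
  -- `b • y` lies in `R ⊆ O`.
  have hlt : O.valuation (toField Φ (b • y)) < 1 := by
    rw [hy, smul_comm]
    exact smul_mem_reductionKernel hcoeff _ hmem
  have hle : O.valuation (toField Φ (b • y))⁻¹ ≤ 1 := (O.valuation_le_one_iff _).2 (hRO hinv)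
  rw [map_inv₀, inv_le_one₀ ((Valuation.pos_iff _).2 hne)] at hle
  exact absurd hlt (not_lt.2 hle)

end DrinfeldAdele

/-! ### Good places and separation of the points of `Γ`. -/

namespace DrinfeldAdele

variable {p : ℕ} [Fact p.Prime] {K : Type u} [Field K] {Φ : SpecialDrinfeldModule p K} {g : ℕ}
  {Γ : Submodule (ZMod p)[X] (Fin g → Pt Φ K)}

/-- All but finitely many places are good, in the sense that a place is good as soon as finitely
many elements are units there. -/
theorem exists_finset_forall_mem_goodPlaces (Ω : Set (ValuationSubring K)) (hΓ : Γ.FG) :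
    ∃ E : Finset K, (∀ n, (Φ.hom X).poly.coeff n ∈ E) ∧
      ∀ O ∈ Ω, (∀ e ∈ E, e ≠ 0 → e ∈ O ∧ e⁻¹ ∈ O) → O ∈ goodPlaces Ω Φ Γ := by
  classical
  obtain ⟨T, rfl⟩ := hΓ
  set P := (Φ.hom X).poly
  have hP : P ≠ 0 := by
    obtain ⟨d, D, c, -, hdD, -, hD, h⟩ := Φ.special
    intro h0
    have hc : P.coeff (p ^ D) = c D := by
      rw [show P = _ from h, finsetSum_coeff, Finset.sum_eq_single D]
      · simp
      · intro i _ hi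
        rw [coeff_C_mul_X_pow, if_neg]
        exact fun h => hi (Nat.pow_right_injective (Fact.out : p.Prime).two_le h).symm
      · intro h
        exact absurd (Finset.mem_Icc.2 ⟨hdD, le_rfl⟩) h
    rw [h0, coeff_zero] at hc
    exact hD hc.symm
  -- Zero is inserted so that the coefficients beyond the degree also belong to the set.
  refine ⟨insert 0 ((Finset.range (P.natDegree + 1)).image P.coeff ∪
    (T ×ˢ Finset.univ).image fun x => toField Φ (x.1 x.2)), ?_, ?_⟩
  · intro n
    by_cases hn : n ≤ P.natDegree
    · exact Finset.mem_insert_of_mem (Finset.mem_union_left _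
        (Finset.mem_image_of_mem _ (Finset.mem_range.2 (Nat.lt_succ_of_le hn))))
    · rw [coeff_eq_zero_of_natDegree_lt (not_le.1 hn)]
      exact Finset.mem_insert_self _ _
  · intro O hO hE
    have hmem : ∀ e ∈ (Finset.range (P.natDegree + 1)).image P.coeff ∪
        (T ×ˢ Finset.univ).image (fun x => toField Φ (x.1 x.2)), e ∈ O := by
      intro e he
      rcases eq_or_ne e 0 with rfl | h0
      · exact zero_mem _
      · exact (hE e (Finset.mem_insert_of_mem he) h0).1
    have hcoeffE : ∀ n ≤ P.natDegree, P.coeff n ∈ (Finset.range (P.natDegree + 1)).image P.coeff ∪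
        (T ×ˢ Finset.univ).image (fun x => toField Φ (x.1 x.2)) := fun n hn =>
      Finset.mem_union_left _ (Finset.mem_image_of_mem _ (Finset.mem_range.2 (Nat.lt_succ_of_le hn)))
    have hcoeff : ∀ n, P.coeff n ∈ O := by
      intro n
      by_cases hn : n ≤ P.natDegree
      · exact hmem _ (hcoeffE n hn)
      · rw [coeff_eq_zero_of_natDegree_lt (not_le.1 hn)]
        exact zero_mem _
    have hunit : ∀ n ≤ P.natDegree, P.coeff n ≠ 0 → O.valuation (P.coeff n) = 1 := by
      intro n hn h0
      obtain ⟨h1, h2⟩ := hE _ (Finset.mem_insert_of_mem (hcoeffE n hn)) h0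
      refine le_antisymm ((O.valuation_le_one_iff _).2 h1) ?_
      have := (O.valuation_le_one_iff _).2 h2
      rwa [map_inv₀, inv_le_one₀ ((Valuation.pos_iff _).2 h0)] at this
    refine ⟨hO, hcoeff, ?_, ?_, ?_⟩
    · exact hunit _ P.natTrailingDegree_le_natDegree (trailingCoeff_nonzero_iff_nonzero.2 hP)
    · exact hunit _ le_rfl (leadingCoeff_ne_zero.2 hP)
    · intro γ hγ i
      change toField Φ (γ i) ∈ O
      induction hγ using Submodule.span_induction with
      | mem x hx =>
        exact hmem _ (Finset.mem_union_right _ (Finset.mem_image.2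
          ⟨(x, i), Finset.mem_product.2 ⟨hx, Finset.mem_univ _⟩, rfl⟩))
      | zero => exact zero_mem _
      | add x y _ _ hx hy => exact add_mem hx hy
      | smul b x _ hx => exact smul_mem_of_coeff_mem hcoeff b hx

/-- The points of `Γ` reducing to zero at finitely many given places. -/
def commonKernel (Γ : Submodule (ZMod p)[X] (Fin g → Pt Φ K)) {Ω : Set (ValuationSubring K)}
    (S : Finset (goodPlaces Ω Φ Γ)) : Submodule (ZMod p)[X] (Fin g → Pt Φ K) where
  carrier := {γ | γ ∈ Γ ∧ ∀ v ∈ S, ∀ i, γ i ∈ reductionKernel Φ v.1}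
  add_mem' hx hy := ⟨add_mem hx.1 hy.1, fun v hv i => add_mem (hx.2 v hv i) (hy.2 v hv i)⟩
  zero_mem' := ⟨zero_mem _, fun _ _ _ => zero_mem _⟩
  smul_mem' b _ hx := ⟨Γ.smul_mem b hx.1, fun v hv i =>
    smul_mem_reductionKernel v.2.2.1 b (hx.2 v hv i)⟩

theorem commonKernel_mono {Ω : Set (ValuationSubring K)} {S S' : Finset (goodPlaces Ω Φ Γ)}
    (h : S ⊆ S') : commonKernel Γ S' ≤ commonKernel Γ S :=
  fun _ hx => ⟨hx.1, fun v hv => hx.2 v (h hv)⟩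

theorem finite_commonKernel_fg (hΓ : Γ.FG) {Ω : Set (ValuationSubring K)}
    (S : Finset (goodPlaces Ω Φ Γ)) : Module.Finite (ZMod p)[X] (commonKernel Γ S) := by
  have : Module.Finite (ZMod p)[X] Γ := Module.Finite.iff_fg.2 hΓ
  exact Module.Finite.of_injective (Submodule.inclusion (fun _ hx => hx.1 : commonKernel Γ S ≤ Γ))
    (Submodule.inclusion_injective _)

/-- A finitely generated torsion module over `𝔽_p[t]` is finite. -/
theorem finite_of_forall_exists_smul_eq_zero {M : Type*} [AddCommGroup M] [Module (ZMod p)[X] M]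
    [Module.Finite (ZMod p)[X] M] (hM : ∀ x : M, ∃ b : (ZMod p)[X], b ≠ 0 ∧ b • x = 0) :
    Finite M := by
  have htor : Module.IsTorsion (ZMod p)[X] M := fun {x} => by
    obtain ⟨b, hb, hx⟩ := hM x
    exact ⟨⟨b, mem_nonZeroDivisors_of_ne_zero hb⟩, hx⟩
  obtain ⟨b, hb, hb0⟩ := Submodule.annihilator_top_inter_nonZeroDivisors htor
  have hb0 := nonZeroDivisors.ne_zero hb0
  have hbM : Module.IsTorsionBySet (ZMod p)[X] M (Ideal.span {b} : Ideal (ZMod p)[X]) := by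
    rw [Module.isTorsionBySet_span_singleton_iff]
    exact fun x => Submodule.mem_annihilator.1 hb x trivial
  let _ : Module ((ZMod p)[X] ⧸ Ideal.span {b}) M := hbM.module
  have : IsScalarTower (ZMod p)[X] ((ZMod p)[X] ⧸ Ideal.span {b}) M := hbM.isScalarTower
  have hfin : Module.Finite (ZMod p) (AdjoinRoot b) := (AdjoinRoot.powerBasis hb0).finite
  have : Finite ((ZMod p)[X] ⧸ Ideal.span {b}) :=
    (Module.finite_of_finite (ZMod p) : Finite (AdjoinRoot b))
  have : Module.Finite ((ZMod p)[X] ⧸ Ideal.span {b}) M :=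
    .of_restrictScalars_finite (ZMod p)[X] _ _
  exact Module.finite_of_finite ((ZMod p)[X] ⧸ Ideal.span {b})

variable {F : Type u} [Field F]
  [Algebra (RatFunc (ZMod p)) F] [FiniteDimensional (RatFunc (ZMod p)) F] [Algebra F K]

/-- Finitely many good places suffice to separate the points of `Γ`. -/
theorem exists_finset_commonKernel_eq_bot [CharP K p] (hK : 1 ≤ Algebra.trdeg F K)
    (V : SmoothProjectiveModel F K) (hΓ : Γ.FG) :
    ∃ S : Finset (goodPlaces V.places Φ Γ), commonKernel Γ S = ⊥ := by
  classical
  obtain ⟨E, hcoeff, hE⟩ := exists_finset_forall_mem_goodPlaces V.places hΓ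
  -- Choosing `S` of minimal rank replaces an induction on the rank of `Γ`.
  obtain ⟨S, hS⟩ : ∃ S : Finset (goodPlaces V.places Φ Γ), ∀ S' : Finset (goodPlaces V.places Φ Γ),
      Module.finrank (ZMod p)[X] (commonKernel Γ S) ≤
        Module.finrank (ZMod p)[X] (commonKernel Γ S') :=
    ⟨_, fun S' => Function.argmin_le
      (fun S : Finset (goodPlaces V.places Φ Γ) =>
        Module.finrank (ZMod p)[X] (commonKernel Γ S)) S'⟩
  have hfg := finite_commonKernel_fg hΓ S
  have htor : ∀ x : commonKernel Γ S, ∃ b : (ZMod p)[X], b ≠ 0 ∧ b • x = 0 := by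
    by_contra! hx
    obtain ⟨x, hx⟩ := hx
    obtain ⟨i, hi⟩ : ∃ i, ∀ b : (ZMod p)[X], b ≠ 0 → b • x.1 i ≠ 0 := by
      by_contra! h
      choose b hb0 hb using h
      refine hx (∏ i, b i) (Finset.prod_ne_zero_iff.2 fun i _ => hb0 i)
        (Subtype.ext (funext fun i => ?_))
      change (∏ i, b i) • x.1 i = 0
      rw [← Finset.prod_erase_mul _ _ (Finset.mem_univ i), mul_smul, hb, smul_zero]
    obtain ⟨O, hO, hOE, hOx⟩ :=
      exists_place_forall_smul_notMem_reductionKernel hK V hi hcoeff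
    let v : goodPlaces V.places Φ Γ := ⟨O, hE O hO hOE⟩
    let N := (commonKernel Γ (insert v S)).submoduleOf (commonKernel Γ S)
    have hle := commonKernel_mono (Γ := Γ) (Finset.subset_insert v S)
    have hrank := Submodule.finrank_quotient_add_finrank N
    have heq : Module.finrank (ZMod p)[X] N =
        Module.finrank (ZMod p)[X] (commonKernel Γ (insert v S)) :=
      (Submodule.submoduleOfEquivOfLe hle).finrank_eq
    -- The class of `x` modulo `N` is non-torsion because no nonzero multiple of its coordinate `i`
    -- reduces to zero at `v`; so the rank drops, contradicting minimality.
    have hpos : Module.finrank (ZMod p)[X] (commonKernel Γ S ⧸ N) ≠ 0 := by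
      rw [ne_eq, Module.finrank_eq_zero_iff]
      intro h
      obtain ⟨b, hb0, hb⟩ := h (Submodule.Quotient.mk x)
      rw [← Submodule.Quotient.mk_smul, Submodule.Quotient.mk_eq_zero] at hb
      exact hOx b hb0 (hb.2 v (Finset.mem_insert_self _ _) i)
    have := hS (insert v S)
    omega
  have hfinite : Finite (commonKernel Γ S) := finite_of_forall_exists_smul_eq_zero htor
  have hcoord : (Set.range fun x : commonKernel Γ S × Fin g => toField Φ (x.1.1 x.2)).Finite :=
    Set.finite_range _
  -- Only the unit conditions matter here, so the trivial valuation ring and the empty set are fed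
  -- in.
  obtain ⟨O, hO, -, -, -, hOE⟩ := V.exists_place (p := p) hK ⊤ ∅ (by simp) (E ∪ hcoord.toFinset)
  let v : goodPlaces V.places Φ Γ :=
    ⟨O, hE O hO fun e he => hOE e (Finset.mem_union_left _ he)⟩
  refine ⟨insert v S, eq_bot_iff.2 fun x hx => funext fun i => by_contra fun h0 => ?_⟩
  have hxS := commonKernel_mono (Γ := Γ) (Finset.subset_insert v S) hx
  have h0' : toField Φ (x i) ≠ 0 := fun h => h0 ((map_eq_zero_iff _ (toField Φ).injective).1 h)
  have hu := (hOE (toField Φ (x i)) (Finset.mem_union_right _ (by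
    rw [Set.Finite.mem_toFinset]
    exact ⟨(⟨x, hxS⟩, i), rfl⟩)) h0').2
  have hlt : O.valuation (toField Φ (x i)) < 1 := hx.2 v (Finset.mem_insert_self _ _) i
  rw [← O.valuation_le_one_iff, map_inv₀, inv_le_one₀ ((Valuation.pos_iff _).2 h0')] at hu
  exact absurd hlt (not_lt.2 hu)

end DrinfeldAdele

/-! ### Discreteness of `Γ` in the adeles. -/

namespace DrinfeldAdele

section Topology

variable {p : ℕ} {K : Type u} [Field K] {Φ : SpecialDrinfeldModule p K} {g : ℕ}
  {Γ : Submodule (ZMod p)[X] (Fin g → Pt Φ K)} {Ω : Set (ValuationSubring K)}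

instance : T2Space (AdelePt Ω Φ Γ) := inferInstanceAs (T2Space (Adeles (goodPlaces Ω Φ Γ)))

theorem continuous_adelePt_eval (v : goodPlaces Ω Φ Γ) :
    Continuous fun x : AdelePt Ω Φ Γ => x.1 v :=
  RestrictedProduct.continuous_eval (R := fun v : goodPlaces Ω Φ Γ => v.1.valuation.Completion) v

/-- The adelic points all of whose coordinates reduce to zero at the places in `S`. -/
def adelicKernel (S : Finset (goodPlaces Ω Φ Γ)) : Set (Fin g → AdelePt Ω Φ Γ) :=
  ⋂ v ∈ S, ⋂ i, {x | Valued.v ((x i).1 v) < 1}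

theorem isOpen_adelicKernel (S : Finset (goodPlaces Ω Φ Γ)) : IsOpen (adelicKernel S) := by
  refine isOpen_biInter_finset fun v _ => isOpen_iInter_of_finite fun i => ?_
  have hball := Valued.isOpen_ball v.1.valuation.Completion 1
  simp only [Valuation.restrict_lt_one_iff] at hball
  exact hball.preimage
    ((continuous_adelePt_eval v).comp
      (continuous_apply (A := fun _ : Fin g => AdelePt Ω Φ Γ) i))

theorem valuation_algebraMap_completion (A : ValuationSubring K) (x : K) :
    Valued.v (algebraMap K A.valuation.Completion x) = A.valuation x :=
  Valued.valuedCompletion_apply (WithVal.toVal A.valuation x)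

theorem bijective_quotientMap (h : Function.Bijective (toClosure Ω Φ Γ)) (a : (ZMod p)[X]) :
    Function.Bijective (quotientMap Ω Φ Γ a) := by
  constructor
  · refine (injective_iff_map_eq_zero _).2 fun x hx => ?_
    obtain ⟨γ, rfl⟩ := Submodule.Quotient.mk_surjective _ x
    obtain ⟨y, hy⟩ := (Submodule.Quotient.mk_eq_zero _).1 hx
    obtain ⟨δ, rfl⟩ := h.2 y
    exact (Submodule.Quotient.mk_eq_zero _).2
      ⟨δ, h.1 (((toClosure Ω Φ Γ).map_smul a δ).trans hy)⟩
  · intro y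
    obtain ⟨y, rfl⟩ := Submodule.Quotient.mk_surjective _ y
    obtain ⟨γ, rfl⟩ := h.2 y
    exact ⟨Submodule.Quotient.mk γ, rfl⟩

variable [Fact p.Prime]

/-- Completion preserves valuations, so the open neighbourhood `adelicKernel S` of zero cuts out on
`Γ` the algebraic submodule `commonKernel Γ S`. -/
theorem diagonal_mem_adelicKernel_iff {S : Finset (goodPlaces Ω Φ Γ)} {γ : Γ} :
    diagonal Ω Φ Γ γ ∈ adelicKernel S ↔ γ.1 ∈ commonKernel Γ S := by
  simp only [adelicKernel, Set.mem_iInter]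
  refine ⟨fun h => ⟨γ.2, fun v hv i => ?_⟩, fun h v hv i => ?_⟩
  · exact (valuation_algebraMap_completion v.1 (γ.1 i)).symm.trans_lt (h v hv i)
  · exact (valuation_algebraMap_completion v.1 (γ.1 i)).trans_lt (h.2 v hv i)

/-- If finitely many good places separate the points of `Γ`, then `Γ` is discrete in the adeles. -/
theorem discreteTopology_range_diagonal {S : Finset (goodPlaces Ω Φ Γ)}
    (hS : commonKernel Γ S = ⊥) :
    DiscreteTopology (LinearMap.range (diagonal Ω Φ Γ)).toAddSubgroup := by
  refine discreteTopology_of_isOpen_singleton_zero ?_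
  refine isOpen_induced_iff.2 ⟨adelicKernel S, isOpen_adelicKernel S, ?_⟩
  ext ⟨_, γ, rfl⟩
  rw [Set.mem_preimage, Set.mem_singleton_iff, diagonal_mem_adelicKernel_iff, hS]
  constructor
  · intro h
    obtain rfl : γ = 0 := Subtype.ext h
    exact Subtype.ext (map_zero _)
  · intro h
    have h : diagonal Ω Φ Γ γ = diagonal Ω Φ Γ 0 := (congrArg Subtype.val h).trans (map_zero _).symm
    have h0 : diagonal Ω Φ Γ γ ∈ adelicKernel S := by
      rw [h, diagonal_mem_adelicKernel_iff]
      exact zero_mem _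
    rw [diagonal_mem_adelicKernel_iff, hS] at h0
    exact h0

theorem bijective_toClosure {S : Finset (goodPlaces Ω Φ Γ)} (hS : commonKernel Γ S = ⊥) :
    Function.Bijective (toClosure Ω Φ Γ) := by
  constructor
  · refine (injective_iff_map_eq_zero _).2 fun γ hγ => ?_
    have h : diagonal Ω Φ Γ γ = diagonal Ω Φ Γ 0 := (congrArg Subtype.val hγ).trans (map_zero _).symm
    have h0 : γ.1 ∈ commonKernel Γ S := by
      rw [← diagonal_mem_adelicKernel_iff, h, diagonal_mem_adelicKernel_iff]
      exact zero_mem _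
    rw [hS] at h0
    exact Subtype.ext h0
  · have := discreteTopology_range_diagonal hS
    have hclosed : IsClosed ((LinearMap.range (diagonal Ω Φ Γ) : Set (Fin g → AdelePt Ω Φ Γ))) :=
      AddSubgroup.isClosed_of_discrete (H := (LinearMap.range (diagonal Ω Φ Γ)).toAddSubgroup)
    rintro ⟨x, hx⟩
    obtain ⟨γ, rfl⟩ := hclosed.closure_subset hx
    exact ⟨γ, rfl⟩

end Topology

end DrinfeldAdele

theorem mainTheorem8 (p : ℕ) [Fact p.Prime] (F K : Type u) [Field F] [Field K]
    [Algebra (RatFunc (ZMod p)) F] [FiniteDimensional (RatFunc (ZMod p)) F]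
    [Algebra F K] [CharP K p] (hK : 1 ≤ Algebra.trdeg F K)
    (V : DrinfeldAdele.SmoothProjectiveModel F K)
    (Φ : DrinfeldAdele.SpecialDrinfeldModule p K)
    (htor : (DrinfeldAdele.tPowerTorsion Φ (SeparableClosure K)).Finite)
    (hmod : 0 < DrinfeldAdele.modularTrdeg Φ)
    (g : ℕ) (hg : 0 < g)
    (Γ : Submodule (ZMod p)[X] (Fin g → DrinfeldAdele.Pt Φ K))
    (hfg : Γ.FG) (hfull : DrinfeldAdele.IsFull Γ)
    (a : (ZMod p)[X]) (ha : a ≠ 0) :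
    Function.Bijective (DrinfeldAdele.quotientMap V.places Φ Γ a) := by
  obtain ⟨S, hS⟩ := DrinfeldAdele.exists_finset_commonKernel_eq_bot (Γ := Γ) hK V hfg
  exact DrinfeldAdele.bijective_quotientMap (DrinfeldAdele.bijective_toClosure hS) a
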